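/- Let $p$ be a prime. Topological vector spaces are Hausdorff. A topological vector space $E$ over a field $\mathbb K$ with a non-trivial absolute value $|\cdot|$ is called polynormed if its topology arises from a family of continuous seminorms $q\colon E\to[0,\infty[$ (so $q(x+y)\le q(x)+q(y)$ and $q(ax)=|a|\,q(x)$). It is called Mackey complete if every Mackey-Cauchy sequence in $E$ converges, where $(x_n)_{n\in\mathbb N}$ is Mackey-Cauchy if there are a bounded set $B\subseteq E$ and $\mu_{n,m}\in\mathbb K$ with $x_n-x_m\in\mu_{n,m}B$ for all $n,m$ and $\mu_{n,m}\to 0$ as both $n,m\to\infty$. A map $f\colon U\to F$ from an open subset $U\subseteq E$ to a topological $\mathbb K$-vector space is $C^0_{\mathbb K}$ if it is continuous. Put $U^{[1]}=\{(x,y,t)\in U\times E\times\mathbb K : x+ty\in U\}$. The map $f$ is $C^1_{\mathbb K}$ if it is continuous and there is a continuous map $f^{[1]}\colon U^{[1]}\to F$ with $f^{[1]}(x,y,t)=\frac1t\bigl(f(x+ty)-f(x)\bigr)$ whenever $t\ne0$; it is $C^{k+1}_{\mathbb K}$ (for $k\ge 1$) if it is $C^1_{\mathbb K}$ and $f^{[1]}$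 is $C^k_{\mathbb K}$; it is smooth if it is $C^k_{\mathbb K}$ for all $k$. Smooth manifolds modelled on a topological $\mathbb K$-vector space, $C^k_{\mathbb K}$-maps between them and smooth Lie groups (with smooth multiplication and inversion) are defined as usual through charts. A map $f\colon M\to N$ between smooth manifolds modelled on polynormed $\mathbb K$-vector spaces $E$ and $F$ is Hölder continuous at $x\in M$ if it is continuous at $x$ and there are $\alpha\in\,]0,1]$, a chart $\phi\colon U_1\to U\subseteq E$ of $M$ around $x$ and a chart $\psi\colon V_1\to V\subseteq F$ of $N$ around $f(x)$ such that the map $g=\psi\circ f\circ\phi^{-1}$, defined on $D=\phi(f^{-1}(V_1)\cap U_1)$, has the following property: for every continuous seminorm $q$ on $F$ there are $\delta>0$, $C>0$ and a continuous seminorm $b$ on $E$ such that $\{y\in E : b(y-\phi(x))<\delta\}\subseteq D$ and $q\bigl(g(y)-g(\phi(x))\bigr)\le C\,b(y-\phi(x))^\alpha$ for all $y\in E$ with $b(y-\phi(x))<\delta$. **Theorem.** Let $f\colon G\to H$ be a group homomorphism between smooth Lie groups modelled on polynormed $\mathbb Q_p$-vector spaces. If $f$ is Hölder continuous at $1$ and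 the modelling space of $H$ is Mackey complete, then $f$ is $C^1_{\mathbb Q_p}$. -/

import Mathlib

open Set Filter Topology

/-! Differential calculus over a valued field `K` (in the sense of Bertram–Glöckner–Neeb),
Lie groups modelled on topological `K`-vector spaces, Hölder continuity at a point, and
Mackey completeness. -/

/-- The set `U^[1] = {(x, y, t) ∈ U × E × K : x + t y ∈ U}`. -/
def stepDomain (K : Type) [NontriviallyNormedField K] {E : Type*} [AddCommGroup E] [Module K E]
    (U : Set E) : Set (E × E × K) :=
  {z | z.1 ∈ U ∧ z.1 + z.2.2 • z.2.1 ∈ U}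

/-- `IsCk K k U f`: the map `f : U → F`, defined on the open subset `U` of the topological
`K`-vector space `E`, is of class `C^k` over `K`.
`C^0` means continuous; `C^(k+1)` means that `f` is continuous and that the difference quotient
`(x, y, t) ↦ t⁻¹ (f (x + t y) - f x)`, for `t ≠ 0`, extends to a map `f^[1] : U^[1] → F` which is
continuous and of class `C^k`. The values of `f` outside `U` (and those of `f^[1]` outside
`U^[1]`) play no role. -/
def IsCk (K : Type) [NontriviallyNormedField K] {F : Type*} [AddCommGroup F] [Module K F]
    [TopologicalSpace F] : ℕ → ∀ {E : Type*} [AddCommGroup E] [Module K E] [TopologicalSpace E],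
      Set E → (E → F) → Prop
  | 0, _, _, _, _, U, f => ContinuousOn f U
  | k + 1, E, _, _, _, U, f =>
      ContinuousOn f U ∧ ∃ f₁ : E × E × K → F,
        ContinuousOn f₁ (stepDomain K U) ∧
        (∀ (x y : E) (t : K), (x, y, t) ∈ stepDomain K U → t ≠ 0 →
          f₁ (x, y, t) = t⁻¹ • (f (x + t • y) - f x)) ∧
        IsCk K k (stepDomain K U) f₁

/-- Smooth (`C^∞`) maps over `K` on an open subset of a topological `K`-vector space. -/
def IsSmoothOver (K : Type) [NontriviallyNormedField K] {E F : Type*}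
    [AddCommGroup E] [Module K E] [TopologicalSpace E]
    [AddCommGroup F] [Module K F] [TopologicalSpace F] (U : Set E) (f : E → F) : Prop :=
  ∀ k : ℕ, IsCk K k U f

/-- Both transition maps between the local homeomorphisms `φ`, `ψ : M → E` are smooth over `K`. -/
def SmoothlyCompatible (K : Type) [NontriviallyNormedField K] {E M : Type*}
    [AddCommGroup E] [Module K E] [TopologicalSpace E] [TopologicalSpace M]
    (φ ψ : OpenPartialHomeomorph M E) : Prop :=
  IsSmoothOver K (φ.target ∩ φ.symm ⁻¹' ψ.source) (fun y => ψ (φ.symm y)) ∧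
  IsSmoothOver K (ψ.target ∩ ψ.symm ⁻¹' φ.source) (fun y => φ (ψ.symm y))

/-- `M`, with its atlas of `E`-valued charts, is a smooth manifold over `K` modelled on `E`. -/
def IsSmoothManifoldOver (K : Type) [NontriviallyNormedField K] (E M : Type*)
    [AddCommGroup E] [Module K E] [TopologicalSpace E] [TopologicalSpace M]
    [ChartedSpace E M] : Prop :=
  ∀ φ ∈ atlas E M, ∀ ψ ∈ atlas E M, SmoothlyCompatible K φ ψ

/-- The charts of the smooth manifold `M`: the members of the maximal smooth atlas. -/
def smoothCharts (K : Type) [NontriviallyNormedField K] (E M : Type*)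
    [AddCommGroup E] [Module K E] [TopologicalSpace E] [TopologicalSpace M]
    [ChartedSpace E M] : Set (OpenPartialHomeomorph M E) :=
  {φ | ∀ ψ ∈ atlas E M, SmoothlyCompatible K φ ψ}

/-- `f : M → N` is of class `C^k` over `K` between smooth manifolds modelled on `E` and `F`:
it is continuous and `C^k` in all charts. -/
def IsCkMap (K : Type) [NontriviallyNormedField K] (E F : Type*)
    [AddCommGroup E] [Module K E] [TopologicalSpace E]
    [AddCommGroup F] [Module K F] [TopologicalSpace F]
    {M N : Type*} [TopologicalSpace M] [ChartedSpace E M] [TopologicalSpace N] [ChartedSpace F N]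
    (k : ℕ) (f : M → N) : Prop :=
  Continuous f ∧ ∀ φ ∈ smoothCharts K E M, ∀ ψ ∈ smoothCharts K F N,
    IsCk K k (φ.target ∩ φ.symm ⁻¹' (f ⁻¹' ψ.source)) (fun y => ψ (f (φ.symm y)))

/-- `G` is a smooth Lie group over `K` modelled on the topological `K`-vector space `E`: a group
which is a smooth manifold, with smooth multiplication `G × G → G` (expressed in the charts
`φ₁ × φ₂` of the product manifold `G × G`, which is modelled on `E × E`) and smooth inversion. -/
structure IsLieGroupOver (K : Type) [NontriviallyNormedField K] (E G : Type*)
    [AddCommGroup E] [Module K E] [TopologicalSpace E]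
    [Group G] [TopologicalSpace G] [ChartedSpace E G] : Prop where
  smooth_manifold : IsSmoothManifoldOver K E G
  continuous_mul : Continuous (fun z : G × G => z.1 * z.2)
  smooth_mul : ∀ φ₁ ∈ smoothCharts K E G, ∀ φ₂ ∈ smoothCharts K E G, ∀ ψ ∈ smoothCharts K E G,
    IsSmoothOver K
      {z : E × E | z.1 ∈ φ₁.target ∧ z.2 ∈ φ₂.target ∧ φ₁.symm z.1 * φ₂.symm z.2 ∈ ψ.source}
      (fun z => ψ (φ₁.symm z.1 * φ₂.symm z.2))
  smooth_inv : ∀ k : ℕ, IsCkMap K E E k (fun g : G => g⁻¹)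

/-- A map `f : U → F` between polynormed `K`-vector spaces is Hölder continuous of degree `α`
at `x`. Note that `p.ball x δ = {y | p (y - x) < δ}`. -/
def HolderAt (K : Type) [NontriviallyNormedField K] {E F : Type*}
    [AddCommGroup E] [Module K E] [TopologicalSpace E]
    [AddCommGroup F] [Module K F] [TopologicalSpace F]
    (α : ℝ) (U : Set E) (f : E → F) (x : E) : Prop :=
  ∀ q : Seminorm K F, Continuous q →
    ∃ δ > (0 : ℝ), ∃ C > (0 : ℝ), ∃ p : Seminorm K E, Continuous p ∧ p.ball x δ ⊆ U ∧
      ∀ y ∈ p.ball x δ, q (f y - f x) ≤ C * p (y - x) ^ α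

/-- A map `f : M → N` between smooth manifolds modelled on polynormed `K`-vector spaces is Hölder
continuous at `x`: it is continuous at `x` and, for some exponent `α ∈ ]0, 1]`, it is Hölder
continuous of degree `α` in some charts around `x` and `f x`. -/
def HolderContinuousAt (K : Type) [NontriviallyNormedField K] (E F : Type*)
    [AddCommGroup E] [Module K E] [TopologicalSpace E]
    [AddCommGroup F] [Module K F] [TopologicalSpace F]
    {M N : Type*} [TopologicalSpace M] [ChartedSpace E M] [TopologicalSpace N] [ChartedSpace F N]
    (f : M → N) (x : M) : Prop :=
  ∃ α : ℝ, 0 < α ∧ α ≤ 1 ∧ ContinuousAt f x ∧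
    ∃ φ ∈ smoothCharts K E M, ∃ ψ ∈ smoothCharts K F N, x ∈ φ.source ∧ f x ∈ ψ.source ∧
      HolderAt K α (φ.target ∩ φ.symm ⁻¹' (f ⁻¹' ψ.source)) (fun y => ψ (f (φ.symm y))) (φ x)

/-- Mackey-Cauchy sequences in a topological `K`-vector space. -/
def IsMackeyCauchy (K : Type) [NontriviallyNormedField K] {E : Type*}
    [AddCommGroup E] [Module K E] [TopologicalSpace E] (x : ℕ → E) : Prop :=
  ∃ (B : Set E) (μ : ℕ × ℕ → K), Bornology.IsVonNBounded K B ∧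
    (∀ n m : ℕ, ∃ b ∈ B, x n - x m = μ (n, m) • b) ∧ Tendsto μ atTop (𝓝 0)

/-- Mackey completeness: every Mackey-Cauchy sequence converges. -/
def MackeyComplete (K : Type) [NontriviallyNormedField K] (E : Type*)
    [AddCommGroup E] [Module K E] [TopologicalSpace E] : Prop :=
  ∀ x : ℕ → E, IsMackeyCauchy K x → ∃ l : E, Tendsto x atTop (𝓝 l)

/-! In charts centred at the units, a group multiplication has the form `x + y + O(x) O(y)`, and `f`
becomes a local homomorphism `h` with `h x = O(x ^ α)`. The scalar `p` is at once a natural number,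
so multiplication by `p` agrees with the `p`-th group power up to `O(x ^ 2)`, and a contraction,
because `‖p‖ < 1` in `ℚ_p`.

If `u` and `v` agree to second order, the quotient of `v` by `u` is `O(x ^ 2)`, so `h` sends it to
`O(x ^ (2 α))`. Hence `h (p x) - p h x = O(x ^ (2 α))` (`isPowO_natCast_smul`). Iterating this along
`p ^ n x` shows that `h` is Hölder of every degree `β ≤ 1` with `β < 2 α` (`IsPowO.of_smul_sub`);
finitely many such improvements give `α = 1` (`lipschitz`).

With `α = 1` the defect is `O(x ^ 2)`, so the sequence `p ^ (-n) h (p ^ n x)` has geometrically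
decaying steps and converges by Mackey completeness. Its limit `L` is additive and continuous, and
`h - L = O(x ^ 2)` (`exists_additive_approx`). Density of `ℚ` in `ℚ_p` makes `L` linear. The group
laws turn this expansion at `0` into convergence of difference quotients at base points near `0`
(`IsHolderHomGerm.isC1At`), and translations carry the result to every point. -/

/-! ### Power bounds measured by continuous seminorms. -/

section BigO

variable {K : Type} [NontriviallyNormedField K]
  {X : Type*} [AddCommGroup X] [Module K X] [TopologicalSpace X]
  {E : Type*} [AddCommGroup E] [Module K E] [TopologicalSpace E]
  {F : Type*} [AddCommGroup F] [Module K F] [TopologicalSpace F]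

theorem Seminorm.tendsto_zero_of_continuous {b : Seminorm K X} (hb : Continuous b) :
    Tendsto b (𝓝 0) (𝓝 0) := by
  simpa using hb.tendsto 0

theorem Seminorm.continuous_sup' {b c : Seminorm K X} (hb : Continuous b) (hc : Continuous c) :
    Continuous (b ⊔ c : Seminorm K X) := by
  have : ((b ⊔ c : Seminorm K X) : X → ℝ) = fun x => max (b x) (c x) := by
    ext x; simp
  rw [this]
  exact hb.max hc

/-- In a polynormed space, every neighbourhood of `0` contains the unit ball of a continuous
seminorm. -/
theorem exists_seminorm_le_one_of_eventually [PolynormableSpace K E] {P : E → Prop}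
    (h : ∀ᶠ x in 𝓝 (0 : E), P x) :
    ∃ c : Seminorm K E, Continuous c ∧ ∀ x, c x ≤ 1 → P x := by
  obtain ⟨s, r, hr, hs⟩ := ((PolynormableSpace.withSeminorms K E).mem_nhds_iff 0 _).1 h
  set c : Seminorm K E := s.sup fun p : {p : Seminorm K E // Continuous p} => p.1
  have := (PolynormableSpace.withSeminorms K E).topologicalAddGroup
  have hcont : Continuous c := Seminorm.continuous_finsetSup fun i _ => i.2
  -- The factor `2 / r` turns the closed unit ball into `c x ≤ r / 2`, which lies inside the open
  -- ball of radius `r`.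
  refine ⟨(2 / r).toNNReal • c, hcont.const_smul (2 / r).toNNReal, fun x hx => hs ?_⟩
  rw [Seminorm.mem_ball_zero]
  have hx' : ((2 / r).toNNReal : ℝ) * c x ≤ 1 := hx
  rw [Real.coe_toNNReal _ (by positivity)] at hx'
  rw [div_mul_eq_mul_div, div_le_one hr] at hx'
  linarith

theorem tendsto_zero_of_seminorm [PolynormableSpace K E] {ι : Type*} {l : Filter ι} {f : ι → E}
    (h : ∀ q : Seminorm K E, Continuous q → Tendsto (fun x => q (f x)) l (𝓝 0)) :
    Tendsto f l (𝓝 0) := by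
  rw [(PolynormableSpace.withSeminorms K E).tendsto_nhds]
  intro q ε hε
  simpa using (h q.1 q.2).eventually_lt_const hε

variable (K) in
/-- `f x = O(x ^ k)` as `x → 0`, with respect to continuous seminorms. -/
def IsPowO (k : ℝ) (f : X → E) : Prop :=
  ∀ q : Seminorm K E, Continuous q → ∃ b : Seminorm K X, Continuous b ∧ ∃ C : ℝ, 0 ≤ C ∧
    ∀ᶠ x in 𝓝 (0 : X), q (f x) ≤ C * b x ^ k

theorem IsPowO.congr {k : ℝ} {f g : X → E} (hf : IsPowO K k f) (h : ∀ᶠ x in 𝓝 0, f x = g x) :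
    IsPowO K k g := by
  intro q hq
  obtain ⟨b, hb, C, hC, H⟩ := hf q hq
  refine ⟨b, hb, C, hC, ?_⟩
  filter_upwards [H, h] with x hx hx'
  rwa [← hx']

theorem IsPowO.add {k : ℝ} (hk : 0 ≤ k) {f g : X → E} (hf : IsPowO K k f) (hg : IsPowO K k g) :
    IsPowO K k (fun x => f x + g x) := by
  intro q hq
  obtain ⟨b, hb, C, hC, H⟩ := hf q hq
  obtain ⟨b', hb', C', hC', H'⟩ := hg q hq
  refine ⟨b ⊔ b', Seminorm.continuous_sup' hb hb', C + C', by positivity, ?_⟩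
  filter_upwards [H, H'] with x hx hx'
  have h1 : b x ^ k ≤ (b ⊔ b') x ^ k :=
    Real.rpow_le_rpow (apply_nonneg _ _) (by simp) hk
  have h2 : b' x ^ k ≤ (b ⊔ b') x ^ k :=
    Real.rpow_le_rpow (apply_nonneg _ _) (by simp) hk
  calc q (f x + g x) ≤ q (f x) + q (g x) := map_add_le_add _ _ _
    _ ≤ C * b x ^ k + C' * b' x ^ k := by gcongr
    _ ≤ C * (b ⊔ b') x ^ k + C' * (b ⊔ b') x ^ k := by gcongr
    _ = _ := by ring

theorem IsPowO.const_smul {k : ℝ} {f : X → E} (hf : IsPowO K k f) (a : K) :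
    IsPowO K k (fun x => a • f x) := by
  intro q hq
  obtain ⟨b, hb, C, hC, H⟩ := hf q hq
  refine ⟨b, hb, ‖a‖ * C, by positivity, ?_⟩
  filter_upwards [H] with x hx
  rw [map_smul_eq_mul, mul_assoc]
  gcongr

theorem IsPowO.neg {k : ℝ} {f : X → E} (hf : IsPowO K k f) : IsPowO K k (fun x => - f x) := by
  simpa using hf.const_smul (-1)

theorem IsPowO.sub {k : ℝ} (hk : 0 ≤ k) {f g : X → E} (hf : IsPowO K k f) (hg : IsPowO K k g) :
    IsPowO K k (fun x => f x - g x) := by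
  simpa [sub_eq_add_neg] using hf.add hk hg.neg

theorem IsPowO.mono {k l : ℝ} (hl : 0 < l) (hlk : l ≤ k) {f : X → E} (hf : IsPowO K k f) :
    IsPowO K l f := by
  intro q hq
  obtain ⟨b, hb, C, hC, H⟩ := hf q hq
  refine ⟨b, hb, C, hC, ?_⟩
  filter_upwards [H, (Seminorm.tendsto_zero_of_continuous hb).eventually_lt_const one_pos]
    with x hx hx'
  refine hx.trans (mul_le_mul_of_nonneg_left ?_ hC)
  rcases (apply_nonneg b x).eq_or_lt with h0 | h0
  · rw [← h0, Real.zero_rpow hl.ne', Real.zero_rpow (hl.trans_le hlk).ne']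
  · exact Real.rpow_le_rpow_of_exponent_ge h0 hx'.le hlk

theorem IsPowO.tendsto_zero [PolynormableSpace K E] {k : ℝ} (hk : 0 < k) {f : X → E}
    (hf : IsPowO K k f) : Tendsto f (𝓝 0) (𝓝 0) := by
  refine tendsto_zero_of_seminorm (K := K) fun q hq => ?_
  obtain ⟨b, hb, C, hC, H⟩ := hf q hq
  refine squeeze_zero' (Eventually.of_forall fun x => apply_nonneg _ _) H ?_
  have := ((Seminorm.tendsto_zero_of_continuous hb).rpow_const (p := k) (Or.inr hk.le)).const_mul C
  simpa [Real.zero_rpow hk.ne'] using this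

theorem IsPowO.comp [PolynormableSpace K E] {k l : ℝ} (hk : 0 ≤ k) (hl : 0 < l) {g : E → F}
    {f : X → E} (hg : IsPowO K k g) (hf : IsPowO K l f) : IsPowO K (k * l) (fun x => g (f x)) := by
  intro q hq
  obtain ⟨b, hb, C, hC, H⟩ := hg q hq
  obtain ⟨b', hb', C', hC', H'⟩ := hf b hb
  refine ⟨b', hb', C * C' ^ k, by positivity, ?_⟩
  filter_upwards [(hf.tendsto_zero hl).eventually H, H'] with x hx hx'
  calc q (g (f x)) ≤ C * b (f x) ^ k := hx
    _ ≤ C * (C' * b' x ^ l) ^ k := by gcongr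
    _ = C * C' ^ k * b' x ^ (k * l) := by
      rw [Real.mul_rpow hC' (Real.rpow_nonneg (apply_nonneg _ _) _),
        ← Real.rpow_mul (apply_nonneg _ _), mul_assoc, mul_comm l k]

theorem IsPowO.of_linear (L : X →ₗ[K] E) (hL : Continuous L) : IsPowO K 1 L := by
  intro q hq
  refine ⟨q.comp L, hq.comp hL, 1, zero_le_one, Eventually.of_forall fun x => ?_⟩
  simp

variable (K) in
/-- `m (x, y) = x + y + O(x) O(y)` as `(x, y) → 0`. -/
def HasBilinearRemainder (m : E × E → E) : Prop :=
  ∀ q : Seminorm K E, Continuous q → ∃ b : Seminorm K E, Continuous b ∧ ∃ C : ℝ, 0 ≤ C ∧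
    ∀ᶠ z in 𝓝 (0 : E × E), q (m z - z.1 - z.2) ≤ C * b z.1 * b z.2

theorem HasBilinearRemainder.comp [PolynormableSpace K E] {m : E × E → E}
    (hm : HasBilinearRemainder K m) {k l : ℝ} (hk : 0 < k) (hl : 0 < l) {f g : X → E}
    (hf : IsPowO K k f) (hg : IsPowO K l g) :
    IsPowO K (k + l) (fun x => m (f x, g x) - f x - g x) := by
  intro q hq
  obtain ⟨b, hb, C, hC, H⟩ := hm q hq
  obtain ⟨b₁, hb₁, C₁, hC₁, H₁⟩ := hf b hb
  obtain ⟨b₂, hb₂, C₂, hC₂, H₂⟩ := hg b hb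
  have ht : Tendsto (fun x => (f x, g x)) (𝓝 0) (𝓝 (0 : E × E)) :=
    (hf.tendsto_zero hk).prodMk_nhds (hg.tendsto_zero hl)
  refine ⟨b₁ ⊔ b₂, Seminorm.continuous_sup' hb₁ hb₂, C * C₁ * C₂, by positivity, ?_⟩
  filter_upwards [ht.eventually H, H₁, H₂] with x hx hx₁ hx₂
  have h1 : b₁ x ^ k ≤ (b₁ ⊔ b₂) x ^ k :=
    Real.rpow_le_rpow (apply_nonneg _ _) (by simp) hk.le
  have h2 : b₂ x ^ l ≤ (b₁ ⊔ b₂) x ^ l :=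
    Real.rpow_le_rpow (apply_nonneg _ _) (by simp) hl.le
  have h3 : b (f x) ≤ C₁ * (b₁ ⊔ b₂) x ^ k := hx₁.trans (by gcongr)
  have h4 : b (g x) ≤ C₂ * (b₁ ⊔ b₂) x ^ l := hx₂.trans (by gcongr)
  calc q (m (f x, g x) - f x - g x) ≤ C * b (f x) * b (g x) := hx
    _ ≤ C * (C₁ * (b₁ ⊔ b₂) x ^ k) * (C₂ * (b₁ ⊔ b₂) x ^ l) := by
      have := apply_nonneg b (g x)
      have := Real.rpow_nonneg (apply_nonneg (b₁ ⊔ b₂) x) k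
      gcongr
    _ = C * C₁ * C₂ * (b₁ ⊔ b₂) x ^ (k + l) := by
      rw [Real.rpow_add_of_nonneg (apply_nonneg _ _) hk.le hl.le]
      ring

end BigO

/-! ### From bounds along powers of a contracting scalar to bounds near zero. -/

section Scaling

variable {K : Type} [NontriviallyNormedField K]
  {E : Type*} [AddCommGroup E] [Module K E]
  {F : Type*} [AddCommGroup F] [Module K F] [TopologicalSpace F]

/-- A power bound along the sequences `ϖ ^ n • x` for `x` in the unit ball of a seminorm
gives a power bound near `0`. -/
theorem Seminorm.le_mul_rpow_of_pow_smul_le (c : Seminorm K E) {ϖ : K} (h0 : ϖ ≠ 0)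
    (h1 : ‖ϖ‖ < 1) {f : E → ℝ} {M β : ℝ} (hβ : 0 < β) {N : ℕ} (hM : 0 ≤ M)
    (h : ∀ x, c x ≤ 1 → ∀ n, N ≤ n → f (ϖ ^ n • x) ≤ M * (‖ϖ‖ ^ n) ^ β)
    {y : E} (hy : c y ≤ ‖ϖ‖ ^ N) : f y ≤ M * (‖ϖ‖⁻¹) ^ β * c y ^ β := by
  have hρ : 0 < ‖ϖ‖ := norm_pos_iff.2 h0
  have key : ∀ n, N ≤ n → c y ≤ ‖ϖ‖ ^ n → f y ≤ M * (‖ϖ‖ ^ n) ^ β := by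
    intro n hn hcy
    have := h ((ϖ ^ n)⁻¹ • y) ?_ n hn
    · rwa [smul_inv_smul₀ (pow_ne_zero n h0)] at this
    · rw [map_smul_eq_mul, norm_inv, norm_pow, inv_mul_le_one₀ (by positivity)]
      exact hcy
  rcases (apply_nonneg c y).eq_or_lt with hc | hc
  -- When `c y = 0`, every `n ≥ N` is admissible in `key`, and its bound tends to `0`.
  · rw [← hc, Real.zero_rpow hβ.ne', mul_zero]
    have hlim : Tendsto (fun n : ℕ => M * (‖ϖ‖ ^ n) ^ β) atTop (𝓝 0) := by
      have := ((tendsto_pow_atTop_nhds_zero_of_lt_one hρ.le h1).rpow_const (p := β)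
        (Or.inr hβ.le)).const_mul M
      simpa [Real.zero_rpow hβ.ne'] using this
    refine ge_of_tendsto hlim ?_
    filter_upwards [eventually_ge_atTop N] with n hn
    exact key n hn (by rw [← hc]; positivity)
  -- Choosing `n` with `‖ϖ‖ ^ (n + 1) < c y ≤ ‖ϖ‖ ^ n` costs only the factor `‖ϖ‖⁻¹ ^ β`.
  · obtain ⟨n, hn1, hn2⟩ := exists_nat_pow_near_of_lt_one hc
      (hy.trans (pow_le_one₀ hρ.le h1.le)) hρ h1
    have hN : N ≤ n := by
      by_contra! hlt
      have : ‖ϖ‖ ^ N ≤ ‖ϖ‖ ^ (n + 1) := pow_le_pow_of_le_one hρ.le h1.le hlt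
      linarith
    refine (key n hN hn2).trans ?_
    rw [mul_assoc, ← Real.mul_rpow (by positivity) hc.le]
    gcongr
    rw [inv_mul_eq_div, le_div_iff₀ hρ, ← pow_succ]
    exact hn1.le

end Scaling

/-! ### First and second order estimates for differentiable maps. -/

section Calculus

variable {K : Type} [NontriviallyNormedField K]
  {E : Type*} [AddCommGroup E] [Module K E] [TopologicalSpace E]
  {E' : Type*} [AddCommGroup E'] [Module K E'] [TopologicalSpace E']
  {F : Type*} [AddCommGroup F] [Module K F] [TopologicalSpace F]

theorem stepDomain_mem_nhds [ContinuousAdd E] [ContinuousSMul K E] {U : Set E} {a : E}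
    (hU : U ∈ 𝓝 a) (v : E) : stepDomain K U ∈ 𝓝 (a, v, (0 : K)) := by
  refine inter_mem (continuous_fst.continuousAt.preimage_mem_nhds hU) ?_
  have : Continuous fun z : E × E × K => z.1 + z.2.2 • z.2.1 := by fun_prop
  refine this.continuousAt.preimage_mem_nhds ?_
  simpa using hU

theorem exists_norm_pow_lt {ϖ : K} (h1 : ‖ϖ‖ < 1) {P : K → Prop} (hP : ∀ᶠ s in 𝓝 0, P s) :
    ∃ N : ℕ, ∀ n, N ≤ n → P (ϖ ^ n) := by
  have := (tendsto_pow_atTop_nhds_zero_of_norm_lt_one h1).eventually hP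
  exact eventually_atTop.1 this

/-- A `C^1`-map is Lipschitz at each point of its domain. -/
theorem IsCk.isPowO_sub [PolynormableSpace K E] [ContinuousAdd E]
    [ContinuousSMul K E] {U : Set E} {g : E → F} {a : E} (hU : U ∈ 𝓝 a) (hg : IsCk K 1 U g) :
    IsPowO K 1 (fun x => g (a + x) - g a) := by
  intro q hq
  obtain ⟨-, g₁, hg₁, hg₁', -⟩ := hg
  obtain ⟨ϖ, h0, h1⟩ := NormedField.exists_norm_lt_one K
  have h0' : ϖ ≠ 0 := norm_pos_iff.1 h0
  have hS := stepDomain_mem_nhds (K := K) hU 0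
  have hcont : ContinuousAt (fun z : E × K => q (g₁ (a, z.1, z.2))) (0, 0) := by
    refine hq.continuousAt.comp ?_
    exact (hg₁.continuousAt hS).comp (f := fun z : E × K => (a, z.1, z.2)) (by fun_prop)
  have hΦ : Tendsto (fun z : E × K => (a, z.1, z.2)) (𝓝 (0, 0)) (𝓝 (a, 0, 0)) :=
    Continuous.tendsto (by fun_prop) _
  have hev := (hcont.eventually_lt_const (lt_add_one _)).and (hΦ.eventually hS)
  rw [nhds_prod_eq, eventually_prod_iff] at hev
  obtain ⟨pE, hpE, pK, hpK, hP⟩ := hev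
  obtain ⟨c, hc, hcE⟩ := exists_seminorm_le_one_of_eventually (K := K) hpE
  obtain ⟨N, hN⟩ := exists_norm_pow_lt h1 hpK
  -- By continuity, `M` bounds `q ∘ g₁` near `(a, 0, 0)`; the increment of `g` along `ϖ ^ n • x` is
  -- `ϖ ^ n` times such a value.
  set M := q (g₁ (a, 0, 0)) + 1 with hMdef
  have hM : 0 ≤ M := add_nonneg (apply_nonneg _ _) zero_le_one
  refine ⟨c, hc, M * (‖ϖ‖⁻¹) ^ (1 : ℝ), by positivity, ?_⟩
  filter_upwards [(Seminorm.tendsto_zero_of_continuous hc).eventually_le_const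
    (pow_pos h0 N)] with y hy
  refine Seminorm.le_mul_rpow_of_pow_smul_le c h0' h1
    (f := fun x => q (g (a + x) - g a)) one_pos hM (fun x hx n hn => ?_) hy
  obtain ⟨hlt, hmem⟩ := hP (hcE x hx) (hN n hn)
  have hpow : ϖ ^ n ≠ 0 := pow_ne_zero n h0'
  have := hg₁' a x (ϖ ^ n) hmem hpow
  rw [eq_inv_smul_iff₀ hpow] at this
  rw [← this, map_smul_eq_mul, norm_pow, Real.rpow_one, mul_comm]
  gcongr

/-- The mixed second difference of a `C^2`-map is `O(x) O(y)`. -/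
theorem IsCk.mixed_difference_le [PolynormableSpace K E] [PolynormableSpace K E']
    [ContinuousAdd E] [ContinuousSMul K E] [ContinuousAdd E'] [ContinuousSMul K E']
    {U : Set (E × E')} {g : E × E' → F}
    {a : E} {b : E'} (hU : U ∈ 𝓝 (a, b)) (hg : IsCk K 2 U g) {q : Seminorm K F}
    (hq : Continuous q) :
    ∃ c : Seminorm K E, Continuous c ∧ ∃ d : Seminorm K E', Continuous d ∧ ∃ C : ℝ, 0 ≤ C ∧
      ∀ᶠ z in 𝓝 (0 : E × E'), q (g (a + z.1, b + z.2) - g (a + z.1, b) -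
        (g (a, b + z.2) - g (a, b))) ≤ C * c z.1 * d z.2 := by
  obtain ⟨-, g₁, -, hg₁', -, g₂, hg₂, hg₂', -⟩ := hg
  obtain ⟨ϖ, h0, h1⟩ := NormedField.exists_norm_lt_one K
  have h0' : ϖ ≠ 0 := norm_pos_iff.1 h0
  have hS := stepDomain_mem_nhds (K := K) hU 0
  have hS₂ := stepDomain_mem_nhds (K := K) hS 0
  -- The inner quotient steps by `t` in direction `(0, y)`; the outer one moves its base point by
  -- `s` in direction `(x, 0)`. Thus `s t g₂ (Φ ((x, y), t, s))` is the mixed second difference with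
  -- increments `s x` and `t y`.
  let Φ : (E × E') × K × K → ((E × E') × (E × E') × K) × ((E × E') × (E × E') × K) × K :=
    fun z => (((a, b), (0, z.1.2), z.2.1), ((z.1.1, 0), 0, 0), z.2.2)
  have hΦ : Continuous Φ := by fun_prop
  have hΦ0 : Tendsto Φ (𝓝 0) (𝓝 (((a, b), 0, 0), 0, 0)) := hΦ.tendsto' _ _ rfl
  have hcont : Tendsto (fun z => q (g₂ (Φ z))) (𝓝 0) (𝓝 (q (g₂ (((a, b), 0, 0), 0, 0)))) :=
    (hq.tendsto _).comp ((hg₂.continuousAt hS₂).tendsto.comp hΦ0)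
  have hev := (hcont.eventually_lt_const (lt_add_one _)).and (hΦ0.eventually hS₂)
  rw [show (0 : (E × E') × K × K) = ((0, 0), 0, 0) from rfl, nhds_prod_eq,
    eventually_prod_iff] at hev
  obtain ⟨pEE, hpEE, pK, hpK, hP⟩ := hev
  rw [nhds_prod_eq, eventually_prod_iff] at hpEE hpK
  obtain ⟨pE, hpE, pE', hpE', hP₁⟩ := hpEE
  obtain ⟨pt, hpt, ps, hps, hP₂⟩ := hpK
  obtain ⟨c, hc, hcE⟩ := exists_seminorm_le_one_of_eventually (K := K) hpE
  obtain ⟨d, hd, hdE⟩ := exists_seminorm_le_one_of_eventually (K := K) hpE'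
  obtain ⟨N, hN⟩ := exists_norm_pow_lt h1 (hpt.and hps)
  set M := q (g₂ (((a, b), 0, 0), 0, 0)) + 1 with hMdef
  have hM : 0 ≤ M := add_nonneg (apply_nonneg _ _) zero_le_one
  set B : E → E' → ℝ := fun x y => q (g (a + x, b + y) - g (a + x, b) -
        (g (a, b + y) - g (a, b))) with hB
  have main : ∀ x, c x ≤ 1 → ∀ y, d y ≤ 1 → ∀ k, N ≤ k → ∀ n, N ≤ n →
      B (ϖ ^ k • x) (ϖ ^ n • y) ≤ M * ‖ϖ‖ ^ k * ‖ϖ‖ ^ n := by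
    intro x hx y hy k hk n hn
    obtain ⟨hlt, hmem⟩ := hP (hP₁ (hcE x hx) (hdE y hy)) (hP₂ (hN n hn).1 (hN k hk).2)
    have hk0 : ϖ ^ k ≠ 0 := pow_ne_zero k h0'
    have hn0 : ϖ ^ n ≠ 0 := pow_ne_zero n h0'
    have e₂ := hg₂' _ _ _ hmem hk0
    rw [eq_inv_smul_iff₀ hk0] at e₂
    have e₁ := hg₁' (a, b) (0, y) (ϖ ^ n) hmem.1 hn0
    have e₁' := hg₁' (a + ϖ ^ k • x, b) (0, y) (ϖ ^ n)
      (by simpa [Φ] using hmem.2) hn0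
    rw [eq_inv_smul_iff₀ hn0] at e₁ e₁'
    simp only [Prod.smul_mk, Prod.mk_add_mk, smul_zero, add_zero] at e₁ e₁' e₂
    have : g (a + ϖ ^ k • x, b + ϖ ^ n • y) - g (a + ϖ ^ k • x, b) -
        (g (a, b + ϖ ^ n • y) - g (a, b)) =
        ϖ ^ n • ϖ ^ k • g₂ (Φ ((x, y), ϖ ^ n, ϖ ^ k)) := by
      rw [← e₁, ← e₁', ← smul_sub]
      congr 1
      exact e₂.symm
    rw [hB]
    dsimp only
    rw [this, map_smul_eq_mul, map_smul_eq_mul, norm_pow, norm_pow]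
    have : q (g₂ (Φ ((x, y), ϖ ^ n, ϖ ^ k))) ≤ M := hlt.le
    calc _ ≤ ‖ϖ‖ ^ n * (‖ϖ‖ ^ k * M) := by gcongr
      _ = _ := by ring
  refine ⟨c, hc, d, hd, M * ‖ϖ‖⁻¹ * ‖ϖ‖⁻¹, by positivity, ?_⟩
  have hcs := (Seminorm.tendsto_zero_of_continuous hc).eventually_le_const (pow_pos h0 N)
  have hds := (Seminorm.tendsto_zero_of_continuous hd).eventually_le_const (pow_pos h0 N)
  rw [show (0 : E × E') = (0, 0) from rfl, nhds_prod_eq]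
  filter_upwards [hcs.prod_mk hds] with z hz
  -- The scaling lemma is applied in one variable at a time: in `y` for fixed `ϖ ^ k • x`, and
  -- afterwards in `x`.
  have step : ∀ x, c x ≤ 1 → ∀ k, N ≤ k →
      B (ϖ ^ k • x) z.2 ≤ M * ‖ϖ‖⁻¹ * d z.2 * (‖ϖ‖ ^ k) ^ (1 : ℝ) := by
    intro x hx k hk
    have := Seminorm.le_mul_rpow_of_pow_smul_le d h0' h1 (f := B (ϖ ^ k • x)) one_pos
      (M := M * ‖ϖ‖ ^ k) (by positivity)
      (fun y hy n hn => by simpa using main x hx y hy k hk n hn) hz.2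
    refine this.trans (le_of_eq ?_)
    simp only [Real.rpow_one]
    ring
  have := Seminorm.le_mul_rpow_of_pow_smul_le c h0' h1 (f := fun x => B x z.2) one_pos
    (by have := apply_nonneg d z.2; positivity) step hz.1
  refine this.trans (le_of_eq ?_)
  simp only [Real.rpow_one]
  ring

end Calculus

/-! ### Group germs, Hölder homomorphisms and the gain in exponent. -/

section LocalGroup

variable {K : Type} [NontriviallyNormedField K]
  {X : Type*} [AddCommGroup X] [Module K X] [TopologicalSpace X]
  {E : Type*} [AddCommGroup E] [Module K E] [TopologicalSpace E]
  {F : Type*} [AddCommGroup F] [Module K F] [TopologicalSpace F]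

variable (K) in
/-- The germ at `0` of a group multiplication `m` with inversion `i`. -/
structure IsGroupGerm (m : E × E → E) (i : E → E) : Prop where
  remainder : HasBilinearRemainder K m
  isPowO_inv : IsPowO K 1 i
  inv_mul : ∀ᶠ x in 𝓝 (0 : E), m (i x, x) = 0
  mul_inv_mul : ∀ᶠ z in 𝓝 (0 : E × E), m (z.1, m (i z.1, z.2)) = z.2

/-- Powers with respect to a multiplication `m` with neutral element `0`. -/
def mulIter (m : E × E → E) : ℕ → E → E
  | 0, _ => 0
  | k + 1, x => m (mulIter m k x, x)

theorem isPowO_zero (k : ℝ) : IsPowO K k (fun _ : X => (0 : E)) := fun q _ =>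
  ⟨0, continuous_const, 0, le_rfl, by simp⟩

theorem isPowO_id : IsPowO K 1 (fun x : E => x) :=
  IsPowO.of_linear LinearMap.id continuous_id

variable [PolynormableSpace K E] [PolynormableSpace K F]

theorem HasBilinearRemainder.isPowO_one {m : E × E → E} (hm : HasBilinearRemainder K m)
    {k : ℝ} (hk : 0 < k) {f g : X → E} (hf : IsPowO K k f) (hg : IsPowO K k g) :
    IsPowO K k (fun x => m (f x, g x)) := by
  have h := (((hm.comp hk hk hf hg).mono hk (by linarith)).add hk.le hf).add hk.le hg
  exact h.congr (Eventually.of_forall fun x => by abel)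

/-- Each further factor `x` contributes a remainder `O(x) O(x)`. The first-order bound is carried
along because the next remainder depends on it. -/
theorem isPowO_mulIter {m : E × E → E} (hm : HasBilinearRemainder K m) (k : ℕ) :
    IsPowO K 1 (mulIter m k) ∧ IsPowO K 2 (fun x => mulIter m k x - (k : K) • x) := by
  induction k with
  | zero => exact ⟨isPowO_zero 1, (isPowO_zero 2).congr (by simp [mulIter])⟩
  | succ k ih =>
    refine ⟨hm.isPowO_one one_pos ih.1 isPowO_id, ?_⟩
    have h := hm.comp one_pos one_pos ih.1 isPowO_id
    rw [one_add_one_eq_two] at h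
    refine (h.add zero_le_two ih.2).congr (Eventually.of_forall fun x => ?_)
    simp only [mulIter, Nat.cast_succ, add_smul, one_smul]
    abel

/-- The product of `i u` and `v` is compared with that of `i u` and `u`, which vanishes; the terms
`i u` cancel. So `i = O(x)` suffices, without a second-order expansion of the inversion. -/
theorem IsGroupGerm.isPowO_div_sub {m : E × E → E} {i : E → E} (hm : IsGroupGerm K m i)
    {u v : X → E} (hu : IsPowO K 1 u) (hv : IsPowO K 1 v) :
    IsPowO K 2 (fun x => m (i (u x), v x) - (v x - u x)) := by
  have hi : IsPowO K 1 (fun x => i (u x)) := by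
    simpa using hm.isPowO_inv.comp zero_le_one one_pos hu
  have h₁ := hm.remainder.comp one_pos one_pos hi hv
  have h₂ := hm.remainder.comp one_pos one_pos hi hu
  rw [one_add_one_eq_two] at h₁ h₂
  refine (h₁.sub zero_le_two h₂).congr ?_
  filter_upwards [(hu.tendsto_zero one_pos).eventually hm.inv_mul] with x hx
  rw [hx]
  abel

variable (K) in
/-- `h` is the germ of a homomorphism from `m` to `n`, Hölder continuous of degree `α`. -/
structure IsHolderHomGerm (m : E × E → E) (n : F × F → F) (α : ℝ) (h : E → F) : Prop where
  map_zero : h 0 = 0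
  map_mul : ∀ᶠ z in 𝓝 (0 : E × E), h (m z) = n (h z.1, h z.2)
  isPowO : IsPowO K α h

variable {m : E × E → E} {i : E → E} {n : F × F → F} {h : E → F} {α : ℝ}

theorem IsHolderHomGerm.isPowO_sub_sub (hn : HasBilinearRemainder K n)
    (hh : IsHolderHomGerm K m n α h) (hα : 0 < α) {u v : X → E}
    (hu : IsPowO K 1 u) (hv : IsPowO K 1 v) :
    IsPowO K (2 * α) (fun x => h (m (u x, v x)) - h (u x) - h (v x)) := by
  have h₁ := hh.isPowO.comp hα.le one_pos hu
  have h₂ := hh.isPowO.comp hα.le one_pos hv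
  rw [mul_one] at h₁ h₂
  have h₃ := hn.comp hα hα h₁ h₂
  rw [← two_mul] at h₃
  refine h₃.congr ?_
  have ht : Tendsto (fun x => (u x, v x)) (𝓝 0) (𝓝 (0 : E × E)) :=
    (hu.tendsto_zero one_pos).prodMk_nhds (hv.tendsto_zero one_pos)
  filter_upwards [ht.eventually hh.map_mul] with x hx
  rw [hx]

/-- A Hölder continuous homomorphism of degree `α` takes maps which agree to second order
to maps which differ by `O(x ^ (2 α))`. -/
theorem IsHolderHomGerm.isPowO_sub_of_isPowO_sub (hm : IsGroupGerm K m i)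
    (hn : HasBilinearRemainder K n) (hh : IsHolderHomGerm K m n α h) (hα : 0 < α) {u v : X → E}
    (hu : IsPowO K 1 u) (hv : IsPowO K 1 v) (huv : IsPowO K 2 (fun x => v x - u x)) :
    IsPowO K (2 * α) (fun x => h (v x) - h (u x)) := by
  have hα2 : 0 ≤ 2 * α := by positivity
  -- The quotient `r` of `v` by `u` is `O(x ^ 2)`, so `h r = O(x ^ (2 α))`; since `v` is the product
  -- of `u` and `r`, it remains to split `h` on that product.
  have hr : IsPowO K 2 (fun x => m (i (u x), v x)) :=
    ((hm.isPowO_div_sub hu hv).add zero_le_two huv).congr (Eventually.of_forall fun x => by abel)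
  have h₁ := hh.isPowO_sub_sub hn hα hu (hr.mono one_pos one_le_two)
  have h₂ := hh.isPowO.comp hα.le two_pos hr
  rw [mul_comm] at h₂
  refine (h₁.add hα2 h₂).congr ?_
  have ht : Tendsto (fun x => (u x, v x)) (𝓝 0) (𝓝 (0 : E × E)) :=
    (hu.tendsto_zero one_pos).prodMk_nhds (hv.tendsto_zero one_pos)
  filter_upwards [ht.eventually hm.mul_inv_mul] with x hx
  rw [hx]
  abel

omit [PolynormableSpace K F] in
theorem IsHolderHomGerm.eventually_map_mulIter (hm : HasBilinearRemainder K m)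
    (hh : IsHolderHomGerm K m n α h) (k : ℕ) :
    ∀ᶠ x in 𝓝 0, h (mulIter m k x) = mulIter n k (h x) := by
  induction k with
  | zero => simp [mulIter, hh.map_zero]
  | succ k ih =>
    have ht : Tendsto (fun x => (mulIter m k x, x)) (𝓝 0) (𝓝 (0 : E × E)) :=
      ((isPowO_mulIter hm k).1.tendsto_zero one_pos).prodMk_nhds tendsto_id
    filter_upwards [ih, ht.eventually hh.map_mul] with x hx hx'
    simp only [mulIter, hx', hx]

/-- The failure of a Hölder continuous homomorphism to commute with multiplication by a natural
number `k` is `O(x ^ (2 α))`. -/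
theorem IsHolderHomGerm.isPowO_natCast_smul [ContinuousSMul K E] (hm : IsGroupGerm K m i)
    (hn : HasBilinearRemainder K n) (hh : IsHolderHomGerm K m n α h) (hα : 0 < α) (k : ℕ) :
    IsPowO K (2 * α) (fun x => h ((k : K) • x) - (k : K) • h x) := by
  have hα2 : 0 ≤ 2 * α := by positivity
  have hP := isPowO_mulIter hm.remainder k
  have hk : IsPowO K 1 (fun x : E => (k : K) • x) := isPowO_id.const_smul _
  have h₁ := hh.isPowO_sub_of_isPowO_sub hm hn hα hk hP.1 hP.2
  have h₂ := (isPowO_mulIter hn k).2.comp zero_le_two hα hh.isPowO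
  refine (h₂.sub hα2 h₁).congr ?_
  filter_upwards [hh.eventually_map_mulIter hm.remainder k] with x hx
  rw [hx]
  abel

/-- Hölder continuous homomorphisms are additive up to `O(x ^ (2 α))`. -/
theorem IsHolderHomGerm.isPowO_add (hm : IsGroupGerm K m i) [ContinuousAdd E]
    (hn : HasBilinearRemainder K n) (hh : IsHolderHomGerm K m n α h) (hα : 0 < α) :
    IsPowO K (2 * α) (fun z : E × E => h (z.1 + z.2) - h z.1 - h z.2) := by
  have hα2 : 0 ≤ 2 * α := by positivity
  have hf : IsPowO K 1 (fun z : E × E => z.1) :=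
    IsPowO.of_linear (LinearMap.fst K E E) continuous_fst
  have hs : IsPowO K 1 (fun z : E × E => z.2) :=
    IsPowO.of_linear (LinearMap.snd K E E) continuous_snd
  have hr := hm.remainder.comp one_pos one_pos hf hs
  rw [one_add_one_eq_two] at hr
  have h₁ := hh.isPowO_sub_of_isPowO_sub hm hn hα (hf.add zero_le_one hs)
    (hm.remainder.isPowO_one one_pos hf hs)
    (hr.congr (Eventually.of_forall fun x => by abel))
  have h₂ := hh.isPowO_sub_sub hn hα hf hs
  exact (h₂.sub hα2 h₁).congr (Eventually.of_forall fun x => by abel)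

omit [PolynormableSpace K F] in
/-- If `h (ϖ x) - ϖ h x = O(x ^ γ)`, then `h` is Hölder continuous of each degree `β ≤ 1` with
`β < γ`. -/
theorem IsPowO.of_smul_sub {ϖ : K} (h0 : ϖ ≠ 0) (h1 : ‖ϖ‖ < 1)
    {β γ : ℝ} (hα : 0 < α) (hβ : 0 < β) (hβ1 : β ≤ 1) (hβγ : β < γ) (hh : IsPowO K α h)
    (hD : IsPowO K γ (fun x => h (ϖ • x) - ϖ • h x)) : IsPowO K β h := by
  intro q hq
  have hρ : 0 < ‖ϖ‖ := norm_pos_iff.2 h0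
  have hγ : 0 < γ := hβ.trans hβγ
  obtain ⟨b₀, hb₀, C₀, hC₀, H₀⟩ := hh q hq
  obtain ⟨b₁, hb₁, C, hC, H₁⟩ := hD q hq
  obtain ⟨c, hc, hcH⟩ := exists_seminorm_le_one_of_eventually (K := K) (H₀.and H₁)
  set d := c ⊔ (b₀ ⊔ b₁) with hd
  have hdc : Continuous d := Seminorm.continuous_sup' hc (Seminorm.continuous_sup' hb₀ hb₁)
  have hcd : ∀ x, c x ≤ d x := fun x => by simp [hd]
  have hb₀d : ∀ x, b₀ x ≤ d x := fun x => by simp [hd]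
  have hb₁d : ∀ x, b₁ x ≤ d x := fun x => by simp [hd]
  set θ := ‖ϖ‖ ^ β with hθ
  set η := ‖ϖ‖ ^ γ with hη
  have hθ0 : 0 < θ := Real.rpow_pos_of_pos hρ _
  have hη0 : 0 < η := Real.rpow_pos_of_pos hρ _
  have hηθ : η < θ := Real.rpow_lt_rpow_of_exponent_gt hρ h1 hβγ
  have hρθ : ‖ϖ‖ ≤ θ := by
    simpa using Real.rpow_le_rpow_of_exponent_ge hρ h1.le hβ1
  -- `D` solves `C + D η = D θ`. Adding `D η ^ k` to the bounded quantity absorbs the error `C η ^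
  -- k`, so each step is a clean multiplication by `θ`. Here `β < γ` gives `η < θ`, and `β ≤ 1`
  -- gives `‖ϖ‖ ≤ θ`.
  set D := C / (θ - η) with hDdef
  have hD0 : 0 ≤ D := div_nonneg hC (sub_pos.2 hηθ).le
  have hDC : C + D * η = D * θ := by
    have : D * (θ - η) = C := div_mul_cancel₀ _ (sub_pos.2 hηθ).ne'
    linarith
  have bound : ∀ x, d x ≤ 1 → ∀ k : ℕ, q (h (ϖ ^ k • x)) + D * η ^ k ≤ (C₀ + D) * θ ^ k := by
    intro x hx k
    induction k with
    | zero =>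
      have h₁ : b₀ x ^ α ≤ 1 :=
        Real.rpow_le_one (apply_nonneg _ _) ((hb₀d x).trans hx) hα.le
      have h₂ := (hcH x ((hcd x).trans hx)).1
      have h₃ : C₀ * b₀ x ^ α ≤ C₀ * 1 := by gcongr
      simp only [pow_zero, one_smul, mul_one] at *
      linarith
    | succ k ih =>
      have hdk : d (ϖ ^ k • x) ≤ ‖ϖ‖ ^ k := by
        rw [map_smul_eq_mul, norm_pow]
        exact mul_le_of_le_one_right (by positivity) hx
      have hdk1 : d (ϖ ^ k • x) ≤ 1 := hdk.trans (pow_le_one₀ hρ.le h1.le)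
      have h₂ := (hcH _ ((hcd _).trans hdk1)).2
      have h₃ : b₁ (ϖ ^ k • x) ^ γ ≤ η ^ k := by
        rw [hη, ← Real.rpow_natCast, ← Real.rpow_mul hρ.le, mul_comm, Real.rpow_mul hρ.le,
          Real.rpow_natCast]
        exact Real.rpow_le_rpow (apply_nonneg _ _) ((hb₁d _).trans hdk) hγ.le
      have h₄ : q (h (ϖ ^ (k + 1) • x)) ≤ C * η ^ k + ‖ϖ‖ * q (h (ϖ ^ k • x)) := by
        rw [pow_succ', mul_smul, ← map_smul_eq_mul]
        calc q (h (ϖ • ϖ ^ k • x))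
            = q ((h (ϖ • ϖ ^ k • x) - ϖ • h (ϖ ^ k • x)) + ϖ • h (ϖ ^ k • x)) := by
              rw [sub_add_cancel]
          _ ≤ q (h (ϖ • ϖ ^ k • x) - ϖ • h (ϖ ^ k • x)) + q (ϖ • h (ϖ ^ k • x)) :=
              map_add_le_add _ _ _
          _ ≤ _ := by
              gcongr
              exact h₂.trans (by gcongr)
      have h₅ : ‖ϖ‖ * q (h (ϖ ^ k • x)) ≤ θ * q (h (ϖ ^ k • x)) := by
        have := apply_nonneg q (h (ϖ ^ k • x))
        gcongr
      calc q (h (ϖ ^ (k + 1) • x)) + D * η ^ (k + 1)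
          ≤ (C + D * η) * η ^ k + θ * q (h (ϖ ^ k • x)) := by
            rw [pow_succ η]; linarith
        _ = θ * (q (h (ϖ ^ k • x)) + D * η ^ k) := by rw [hDC]; ring
        _ ≤ θ * ((C₀ + D) * θ ^ k) := by gcongr
        _ = _ := by ring
  refine ⟨d, hdc, (C₀ + D) * ‖ϖ‖⁻¹ ^ β, by positivity, ?_⟩
  filter_upwards [(Seminorm.tendsto_zero_of_continuous hdc).eventually_le_const one_pos] with y hy
  refine Seminorm.le_mul_rpow_of_pow_smul_le d h0 h1 (f := fun x => q (h x)) (N := 0) hβ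
    (by positivity) (fun x hx k _ => ?_) (by simpa using hy)
  have h₁ := bound x hx k
  have h₂ : 0 ≤ D * η ^ k := by positivity
  have h₃ : (‖ϖ‖ ^ k) ^ β = θ ^ k := by
    rw [hθ, ← Real.rpow_natCast, ← Real.rpow_mul hρ.le, mul_comm, Real.rpow_mul hρ.le,
          Real.rpow_natCast]
  rw [h₃]
  linarith

/-- A Hölder continuous homomorphism is Lipschitz at `0`. -/
theorem IsHolderHomGerm.lipschitz [ContinuousSMul K E] (hm : IsGroupGerm K m i)
    (hn : HasBilinearRemainder K n) (hh : IsHolderHomGerm K m n α h) (hα : 0 < α) {k : ℕ}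
    (h0 : (k : K) ≠ 0) (h1 : ‖(k : K)‖ < 1) : IsHolderHomGerm K m n 1 h := by
  -- Any degree at most `1` and strictly below twice the current one is reachable; the factor `3 /
  -- 2` leaves the strict room required.
  have key : ∀ j : ℕ, IsHolderHomGerm K m n (min 1 ((3 / 2) ^ j * α)) h := by
    intro j
    induction j with
    | zero =>
      exact ⟨hh.map_zero, hh.map_mul, hh.isPowO.mono (by positivity) (by simp)⟩
    | succ j ih =>
      have hpos : 0 < min 1 ((3 / 2 : ℝ) ^ j * α) := by positivity
      refine ⟨hh.map_zero, hh.map_mul, (ih.isPowO.of_smul_sub h0 h1 hpos (by positivity)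
        (min_le_left _ _) ?_ (ih.isPowO_natCast_smul hm hn hpos k))⟩
      have : 0 < (3 / 2 : ℝ) ^ j * α := by positivity
      rcases le_total 1 ((3 / 2 : ℝ) ^ j * α) with hle | hle
      · rw [min_eq_left hle]
        exact (min_le_left _ _).trans_lt (by norm_num)
      · rw [min_eq_right hle]
        refine (min_le_right _ _).trans_lt ?_
        rw [pow_succ]
        linarith
  obtain ⟨j, hj⟩ := pow_unbounded_of_one_lt (α⁻¹) (by norm_num : (1 : ℝ) < 3 / 2)
  have hle : 1 ≤ (3 / 2 : ℝ) ^ j * α := by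
    rw [inv_lt_iff_one_lt_mul₀ hα] at hj
    linarith
  simpa [min_eq_left hle] using key j

end LocalGroup

/-! ### The linear approximation as a Mackey limit. -/

section Limit

variable {K : Type} [NontriviallyNormedField K]
  {E : Type*} [AddCommGroup E] [Module K E] [TopologicalSpace E]
  {F : Type*} [AddCommGroup F] [Module K F] [TopologicalSpace F]

omit [TopologicalSpace F] in
-- Telescoping; the finite geometric sum is kept exact in `key` so that the induction closes.
theorem Seminorm.sub_le_of_geometric (q : Seminorm K F) {z : ℕ → F} {ρ A : ℝ} {N : ℕ}
    (hρ0 : 0 < ρ) (hρ1 : ρ < 1) (hA : 0 ≤ A) (h : ∀ n, N ≤ n → q (z (n + 1) - z n) ≤ A * ρ ^ n)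
    {n : ℕ} (hn : N ≤ n) (j : ℕ) : q (z (n + j) - z n) ≤ A / (1 - ρ) * ρ ^ n := by
  have h1 : 0 < 1 - ρ := by linarith
  have key : q (z (n + j) - z n) ≤ A / (1 - ρ) * (ρ ^ n - ρ ^ (n + j)) := by
    induction j with
    | zero => simp
    | succ j ih =>
      have h₂ := h (n + j) (by lia)
      have h₃ : q (z (n + (j + 1)) - z n) ≤
          q (z (n + j + 1) - z (n + j)) + q (z (n + j) - z n) := by
        rw [show z (n + (j + 1)) - z n = (z (n + j + 1) - z (n + j)) + (z (n + j) - z n) by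
          rw [sub_add_sub_cancel, add_assoc]]
        exact map_add_le_add _ _ _
      have h₄ : A * ρ ^ (n + j) = A / (1 - ρ) * (ρ ^ (n + j) - ρ ^ (n + (j + 1))) := by
        field_simp
        ring
      linarith
  refine key.trans (mul_le_mul_of_nonneg_left ?_ (by positivity))
  have : 0 < ρ ^ (n + j) := by positivity
  linarith

/-- A sequence whose successive differences decay geometrically, at the rate of powers of a scalar
and with respect to each continuous seminorm, is Mackey-Cauchy. -/
theorem isMackeyCauchy_of_geometric [PolynormableSpace K F] {ϖ : K} (h0 : ϖ ≠ 0) (h1 : ‖ϖ‖ < 1)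
    {z : ℕ → F} (h : ∀ q : Seminorm K F, Continuous q → ∃ A : ℝ, ∃ N : ℕ, ∀ n, N ≤ n →
      q (z (n + 1) - z n) ≤ A * ‖ϖ‖ ^ n) : IsMackeyCauchy K z := by
  have hρ : 0 < ‖ϖ‖ := norm_pos_iff.2 h0
  -- The bounded set consists of the differences rescaled by the power of `ϖ` at the smaller index,
  -- where the geometric bound is attached.
  refine ⟨range fun a : ℕ × ℕ => (ϖ ^ min a.1 a.2)⁻¹ • (z a.1 - z a.2),
    fun a => ϖ ^ min a.1 a.2, ?_, fun n m => ⟨_, mem_range_self (n, m), ?_⟩, ?_⟩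
  · rw [(PolynormableSpace.withSeminorms K F).isVonNBounded_iff_seminorm_bounded]
    intro q
    obtain ⟨A, N, hA⟩ := h q.1 q.2
    -- Boundedness concerns all indices, whereas `N` depends on `q`; the sum takes care of the
    -- finitely many early steps.
    set A' := |A| + ∑ k ∈ Finset.range N, (‖ϖ‖ ^ k)⁻¹ * q.1 (z (k + 1) - z k) with hA'
    have hsum : 0 ≤ ∑ k ∈ Finset.range N, (‖ϖ‖ ^ k)⁻¹ * q.1 (z (k + 1) - z k) :=
      Finset.sum_nonneg fun k _ => by have := apply_nonneg q.1 (z (k + 1) - z k); positivity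
    have hA'0 : 0 ≤ A' := by positivity
    have hall : ∀ n, 0 ≤ n → q.1 (z (n + 1) - z n) ≤ A' * ‖ϖ‖ ^ n := by
      intro n _
      rcases lt_or_ge n N with hn | hn
      · have := Finset.single_le_sum
          (f := fun k => (‖ϖ‖ ^ k)⁻¹ * q.1 (z (k + 1) - z k))
          (fun k _ => by have := apply_nonneg q.1 (z (k + 1) - z k); positivity)
          (Finset.mem_range.2 hn)
        have h₂ : (‖ϖ‖ ^ n)⁻¹ * q.1 (z (n + 1) - z n) ≤ A' :=
          this.trans (le_add_of_nonneg_left (abs_nonneg _))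
        rwa [inv_mul_le_iff₀ (by positivity), mul_comm] at h₂
      · refine (hA n hn).trans ?_
        gcongr
        exact (le_abs_self A).trans (le_add_of_nonneg_right hsum)
    have hd : 0 ≤ A' / (1 - ‖ϖ‖) := div_nonneg hA'0 (by linarith)
    have key : ∀ n j, q.1 (z (n + j) - z n) ≤ A' / (1 - ‖ϖ‖) * ‖ϖ‖ ^ n := fun n j =>
      q.1.sub_le_of_geometric hρ h1 hA'0 hall (Nat.zero_le n) j
    refine ⟨A' / (1 - ‖ϖ‖) + 1, by positivity, ?_⟩
    rintro _ ⟨⟨n, m⟩, rfl⟩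
    refine lt_of_le_of_lt ?_ (lt_add_one _)
    rw [map_smul_eq_mul, norm_inv, norm_pow, inv_mul_le_iff₀ (by positivity), mul_comm]
    rcases le_total n m with hnm | hnm
    · obtain ⟨j, rfl⟩ := Nat.exists_eq_add_of_le hnm
      rw [map_sub_rev, min_eq_left hnm]
      exact key n j
    · obtain ⟨j, rfl⟩ := Nat.exists_eq_add_of_le hnm
      rw [min_eq_right hnm]
      exact key m j
  · rw [smul_inv_smul₀ (pow_ne_zero _ h0)]
  · refine (tendsto_pow_atTop_nhds_zero_of_norm_lt_one h1).comp ?_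
    refine tendsto_atTop.2 fun N => ?_
    filter_upwards [eventually_ge_atTop (N, N)] with a ha
    exact le_min ha.1 ha.2

variable [PolynormableSpace K E]
  {m : E × E → E} {i : E → E} {n : F × F → F} {h : E → F}

omit [PolynormableSpace K E] in
theorem tendsto_pow_smul_zero [ContinuousSMul K E] {ϖ : K} (h1 : ‖ϖ‖ < 1) (x : E) :
    Tendsto (fun k : ℕ => ϖ ^ k • x) atTop (𝓝 0) := by
  simpa using (tendsto_pow_atTop_nhds_zero_of_norm_lt_one h1).smul_const x

omit [PolynormableSpace K E] in
/-- If `f x = O(x ^ 2)`, then `ϖ ^ (-k) f (ϖ ^ k x)` tends to `0`. -/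
theorem IsPowO.tendsto_inv_pow_smul [PolynormableSpace K F] [ContinuousSMul K E] {ϖ : K}
    (h0 : ϖ ≠ 0) (h1 : ‖ϖ‖ < 1) {f : E → F} (hf : IsPowO K 2 f) (x : E) :
    Tendsto (fun k : ℕ => (ϖ ^ k)⁻¹ • f (ϖ ^ k • x)) atTop (𝓝 0) := by
  have hρ : 0 < ‖ϖ‖ := norm_pos_iff.2 h0
  refine tendsto_zero_of_seminorm (K := K) fun q hq => ?_
  obtain ⟨b, hb, C, hC, H⟩ := hf q hq
  have hlim : Tendsto (fun k : ℕ => C * b x ^ 2 * ‖ϖ‖ ^ k) atTop (𝓝 0) := by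
    simpa using (tendsto_pow_atTop_nhds_zero_of_lt_one hρ.le h1).const_mul (C * b x ^ 2)
  refine squeeze_zero' (Eventually.of_forall fun _ => apply_nonneg _ _) ?_ hlim
  filter_upwards [(tendsto_pow_smul_zero h1 x).eventually H] with k hk
  rw [map_smul_eq_mul, norm_pow, Real.rpow_two] at hk
  rw [map_smul_eq_mul, norm_inv, norm_pow, inv_mul_le_iff₀ (by positivity)]
  exact hk.trans (le_of_eq (by ring))

/-- A Lipschitz homomorphism into a Mackey complete group is approximated to second order by a
continuous additive map. -/
theorem IsHolderHomGerm.exists_additive_approx [PolynormableSpace K F] [IsTopologicalAddGroup E]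
    [ContinuousSMul K E] [IsTopologicalAddGroup F] [ContinuousSMul K F] [T2Space F]
    (hF : MackeyComplete K F) (hm : IsGroupGerm K m i)
    (hn : HasBilinearRemainder K n) (hh : IsHolderHomGerm K m n 1 h) {k : ℕ}
    (h0 : (k : K) ≠ 0) (h1 : ‖(k : K)‖ < 1) :
    ∃ L : E →+ F, Continuous L ∧ IsPowO K 2 (fun x => h x - L x) := by
  set ϖ : K := (k : K) with hϖ
  have hρ : 0 < ‖ϖ‖ := norm_pos_iff.2 h0
  have hD := hh.isPowO_natCast_smul hm hn one_pos k
  rw [mul_one, ← hϖ] at hD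
  set z : E → ℕ → F := fun x k => (ϖ ^ k)⁻¹ • h (ϖ ^ k • x) with hz
  have hdiff : ∀ x k, z x (k + 1) - z x k =
      (ϖ ^ (k + 1))⁻¹ • (h (ϖ • ϖ ^ k • x) - ϖ • h (ϖ ^ k • x)) := by
    intro x k
    have : (ϖ ^ (k + 1))⁻¹ * ϖ = (ϖ ^ k)⁻¹ := by
      rw [pow_succ]
      field_simp
    simp only [hz, smul_sub, smul_smul, this]
    rw [pow_succ']
  -- The condition on `c (ϖ ^ k • x)` serves two purposes: it holds for large `k` at any fixed `x`,
  -- which gives convergence, and for all `k` when `c x ≤ 1`, which gives the uniform approximation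
  -- near `0`.
  have hest : ∀ q : Seminorm K F, Continuous q → ∃ c : Seminorm K E, Continuous c ∧ ∃ C : ℝ,
      0 ≤ C ∧ ∀ x k, c (ϖ ^ k • x) ≤ 1 → q (z x (k + 1) - z x k) ≤ C * c x ^ 2 * ‖ϖ‖ ^ k := by
    intro q hq
    obtain ⟨b, hb, C, hC, H⟩ := hD q hq
    obtain ⟨c, hc, hcH⟩ := exists_seminorm_le_one_of_eventually (K := K) H
    refine ⟨c ⊔ b, Seminorm.continuous_sup' hc hb, C * ‖ϖ‖⁻¹, by positivity, fun x k hx => ?_⟩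
    have hle : c (ϖ ^ k • x) ≤ 1 := le_trans (by simp) hx
    have hq := hcH _ hle
    have hb' : b x ≤ (c ⊔ b) x := by simp
    rw [hdiff, map_smul_eq_mul, norm_inv, norm_pow, inv_mul_le_iff₀ (by positivity)]
    refine hq.trans ?_
    rw [map_smul_eq_mul, norm_pow, Real.rpow_two]
    calc C * (‖ϖ‖ ^ k * b x) ^ 2 ≤ C * (‖ϖ‖ ^ k * (c ⊔ b) x) ^ 2 := by
          have := apply_nonneg b x
          gcongr
      _ = _ := by
          field_simp
          ring
  have hlim : ∀ x, ∃ l, Tendsto (z x) atTop (𝓝 l) := by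
    intro x
    refine hF _ (isMackeyCauchy_of_geometric h0 h1 fun q hq => ?_)
    obtain ⟨c, hc, C, hC, H⟩ := hest q hq
    obtain ⟨N, hN⟩ := eventually_atTop.1 ((tendsto_pow_smul_zero h1 x).eventually
      ((Seminorm.tendsto_zero_of_continuous hc).eventually_le_const one_pos))
    exact ⟨C * c x ^ 2, N, fun n hn => H x n (hN n hn)⟩
  choose L hL using hlim
  have hadd : ∀ x y, L (x + y) = L x + L y := by
    intro x y
    have h₁ := (hh.isPowO_add hm hn one_pos)
    rw [mul_one] at h₁
    -- The additivity defect of `h` is of second order, so it still vanishes after rescaling by `ϖ ^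
    -- (-j)`.
    have h₂ := h₁.tendsto_inv_pow_smul h0 h1 (x, y)
    have h₃ := ((hL (x + y)).sub (hL x)).sub (hL y)
    have h₄ := tendsto_nhds_unique h₃ (h₂.congr fun j => by
      simp only [hz, Prod.smul_mk, smul_sub, smul_add])
    rw [sub_sub, sub_eq_zero] at h₄
    exact h₄
  have happrox : IsPowO K 2 (fun x => h x - L x) := by
    intro q hq
    obtain ⟨c, hc, C, hC, H⟩ := hest q hq
    refine ⟨c, hc, C / (1 - ‖ϖ‖), div_nonneg hC (by linarith), ?_⟩
    filter_upwards [(Seminorm.tendsto_zero_of_continuous hc).eventually_le_const one_pos]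
      with x hx
    have hgeo : ∀ j, 0 ≤ j → q (z x (j + 1) - z x j) ≤ C * c x ^ 2 * ‖ϖ‖ ^ j := fun j _ =>
      H x j (by
        rw [map_smul_eq_mul, norm_pow]
        exact mul_le_one₀ (pow_le_one₀ hρ.le h1.le) (apply_nonneg _ _) hx)
    -- Summation starts at index `0` because `z x 0 = h x`; the bound does not depend on `j` and
    -- passes to the limit.
    have hle : ∀ j, q (z x j - h x) ≤ C / (1 - ‖ϖ‖) * c x ^ (2 : ℝ) := by
      intro j
      have := q.sub_le_of_geometric hρ h1 (by positivity) hgeo le_rfl j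
      rw [zero_add, pow_zero, mul_one] at this
      have hz0 : z x 0 = h x := by simp [hz]
      rw [hz0] at this
      exact this.trans (le_of_eq (by rw [Real.rpow_two]; ring))
    rw [map_sub_rev]
    exact le_of_tendsto ((hq.tendsto _).comp ((hL x).sub_const (h x)))
      (Eventually.of_forall hle)
  let L' : E →+ F := AddMonoidHom.mk' L hadd
  refine ⟨L', ?_, happrox⟩
  have h₁ : IsPowO K 1 L := by
    refine (hh.isPowO.sub zero_le_one (happrox.mono one_pos one_le_two)).congr
      (Eventually.of_forall fun x => by abel)
  refine continuous_of_continuousAt_zero L' ?_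
  have h₂ : L' 0 = 0 := _root_.map_zero L'
  rw [ContinuousAt, h₂]
  exact h₁.tendsto_zero one_pos

/-- Continuous additive maps between topological `ℚ_p`-vector spaces are linear. -/
theorem AddMonoidHom.map_padic_smul {p : ℕ} [Fact p.Prime] {E F : Type*} [AddCommGroup E]
    [Module ℚ_[p] E] [TopologicalSpace E] [ContinuousSMul ℚ_[p] E] [AddCommGroup F]
    [Module ℚ_[p] F] [TopologicalSpace F] [ContinuousSMul ℚ_[p] F] [T2Space F]
    (L : E →+ F) (hL : Continuous L) (t : ℚ_[p]) (x : E) : L (t • x) = t • L x := by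
  -- Additivity gives homogeneity over `ℚ`, and both sides are continuous in `t`.
  refine isClosed_property (p := fun t : ℚ_[p] => L (t • x) = t • L x)
    (Padic.denseRange_ratCast p) (isClosed_eq (by fun_prop) (by fun_prop)) (fun r => ?_) t
  exact map_ratCast_smul L ℚ_[p] ℚ_[p] r x

end Limit

/-! ### Pointwise convergence of difference quotients. -/

section IsC1At

variable {K : Type} [NontriviallyNormedField K]
  {E : Type*} [AddCommGroup E] [Module K E] [TopologicalSpace E]
  {F : Type*} [AddCommGroup F] [Module K F] [TopologicalSpace F]
  {E' : Type*} [AddCommGroup E'] [Module K E'] [TopologicalSpace E']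

variable (K) in
/-- The difference quotient `t⁻¹ (f (x + t y) - f x)`. -/
def diffQuotient (f : E → F) (z : E × E × K) : F := z.2.2⁻¹ • (f (z.1 + z.2.2 • z.2.1) - f z.1)

variable (K) in
/-- `f` is continuous at `x` and its difference quotients `t⁻¹ (f (x' + t y') - f x')` converge
as `(x', y', t) → (x, y, 0)` with `t ≠ 0`, for each direction `y`. -/
def IsC1At (f : E → F) (x : E) : Prop :=
  ContinuousAt f x ∧ ∀ y : E, ∃ l : F,
    Tendsto (diffQuotient K f) (𝓝[{z | z.2.2 ≠ 0}] (x, y, 0)) (𝓝 l)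

theorem tendsto_diffQuotient {f : E → F} {x y : E} {l : F}
    (hl : Tendsto (diffQuotient K f) (𝓝[{z | z.2.2 ≠ 0}] (x, y, 0)) (𝓝 l))
    {ι : Type*} {φ : Filter ι} {x' y' : ι → E} {t : ι → K}
    (hx : Tendsto x' φ (𝓝 x)) (hy : Tendsto y' φ (𝓝 y)) (ht : Tendsto t φ (𝓝 0))
    (h0 : ∀ᶠ a in φ, t a ≠ 0) :
    Tendsto (fun a => (t a)⁻¹ • (f (x' a + t a • y' a) - f (x' a))) φ (𝓝 l) :=
  hl.comp (tendsto_nhdsWithin_iff.2 ⟨hx.prodMk_nhds (hy.prodMk_nhds ht), h0⟩)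

theorem tendsto_add_smul [ContinuousAdd E] [ContinuousSMul K E] (x y : E) :
    Tendsto (fun z : E × E × K => z.1 + z.2.2 • z.2.1) (𝓝[{z | z.2.2 ≠ 0}] (x, y, 0)) (𝓝 x) := by
  have : Continuous fun z : E × E × K => z.1 + z.2.2 • z.2.1 := by fun_prop
  exact (this.tendsto' _ _ (by simp)).mono_left nhdsWithin_le_nhds

omit [AddCommGroup E] [Module K E] in
theorem tendsto_step_fst (x y : E) :
    Tendsto (fun z : E × E × K => z.1) (𝓝[{z | z.2.2 ≠ 0}] (x, y, 0)) (𝓝 x) :=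
  (continuous_fst.tendsto' _ _ rfl).mono_left nhdsWithin_le_nhds

omit [AddCommGroup E] [Module K E] in
theorem tendsto_step_direction (x y : E) :
    Tendsto (fun z : E × E × K => z.2.1) (𝓝[{z | z.2.2 ≠ 0}] (x, y, 0)) (𝓝 y) :=
  ((continuous_fst.comp continuous_snd).tendsto' _ _ rfl).mono_left nhdsWithin_le_nhds

omit [AddCommGroup E] [Module K E] in
theorem tendsto_step_scalar (x y : E) :
    Tendsto (fun z : E × E × K => z.2.2) (𝓝[{z | z.2.2 ≠ 0}] (x, y, 0)) (𝓝 0) :=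
  ((continuous_snd.comp continuous_snd).tendsto' _ _ rfl).mono_left nhdsWithin_le_nhds

omit [AddCommGroup E] [Module K E] in
theorem eventually_step_ne_zero (x y : E) :
    ∀ᶠ z : E × E × K in 𝓝[{z | z.2.2 ≠ 0}] (x, y, 0), z.2.2 ≠ 0 :=
  eventually_mem_nhdsWithin

theorem IsC1At.congr [ContinuousAdd E] [ContinuousSMul K E] {f g : E → F} {x : E}
    (hf : IsC1At K f x) (h : ∀ᶠ y in 𝓝 x, f y = g y) : IsC1At K g x := by
  refine ⟨hf.1.congr h, fun y => ?_⟩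
  obtain ⟨l, hl⟩ := hf.2 y
  refine ⟨l, hl.congr' ?_⟩
  filter_upwards [(tendsto_add_smul x y).eventually h, (tendsto_step_fst x y).eventually h]
    with z hz hz'
  rw [diffQuotient, diffQuotient, hz, hz']

/-- The inner difference quotient is the direction fed to the outer one; this works because the
definition lets base points and directions vary. -/
theorem IsC1At.comp [ContinuousAdd E] [ContinuousSMul K E] {g : E → F} {f : E' → E} {x : E'}
    (hg : IsC1At K g (f x)) (hf : IsC1At K f x) : IsC1At K (fun y => g (f y)) x := by
  refine ⟨ContinuousAt.comp (f := f) hg.1 hf.1, fun y => ?_⟩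
  obtain ⟨l, hl⟩ := hf.2 y
  obtain ⟨l', hl'⟩ := hg.2 l
  refine ⟨l', ?_⟩
  refine (tendsto_diffQuotient hl' (hf.1.tendsto.comp (tendsto_step_fst x y)) hl
    (tendsto_step_scalar x y) (eventually_step_ne_zero x y)).congr' ?_
  filter_upwards [eventually_step_ne_zero x y] with z hz
  simp only [diffQuotient, Function.comp, smul_inv_smul₀ hz, add_sub_cancel]

theorem IsCk.isC1At [ContinuousAdd E] [ContinuousSMul K E] {f : E → F} {U : Set E} {x : E}
    (hU : U ∈ 𝓝 x) (hf : IsCk K 1 U f) : IsC1At K f x := by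
  obtain ⟨h, f₁, hf₁, hf₁', -⟩ := hf
  refine ⟨h.continuousAt hU, fun y => ⟨f₁ (x, y, 0), ?_⟩⟩
  have hS := stepDomain_mem_nhds (K := K) hU y
  refine ((hf₁.continuousAt hS).mono_left nhdsWithin_le_nhds).congr' ?_
  filter_upwards [nhdsWithin_le_nhds hS, eventually_step_ne_zero x y] with z hz hz'
  exact hf₁' _ _ _ hz hz'

/-- The quotient is continuous on the dense set `t ≠ 0` and has limits at `t = 0`, so extension by
limits is continuous, `F` being regular. -/
theorem isCk_one_of_isC1At [ContinuousAdd E] [ContinuousSMul K E] [IsTopologicalAddGroup F]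
    [ContinuousSMul K F] [T2Space F] {f : E → F} {U : Set E}
    (hf : ∀ x ∈ U, IsC1At K f x) : IsCk K 1 U f := by
  have hcont : ContinuousOn f U := fun x hx => (hf x hx).1.continuousWithinAt
  set A : Set (E × E × K) := {z | z.2.2 ≠ 0} with hA
  have hdense : Dense A := by
    have h := (dense_compl_singleton (0 : K)).preimage
      (isOpenMap_snd.comp isOpenMap_snd : IsOpenMap fun z : E × E × K => z.2.2)
    exact h
  have hlim : ∀ z ∈ stepDomain K U, z.2.2 ≠ 0 →
      ContinuousAt (diffQuotient K f) z := by
    intro z hz hz0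
    have h₁ : ContinuousAt (fun z : E × E × K => f z.1) z :=
      ContinuousAt.comp (g := f) (hf _ hz.1).1 continuousAt_fst
    have h₂ : ContinuousAt (fun z : E × E × K => f (z.1 + z.2.2 • z.2.1)) z :=
      ContinuousAt.comp (g := f) (f := fun z : E × E × K => z.1 + z.2.2 • z.2.1)
        (hf _ hz.2).1 (by fun_prop)
    have h₃ : ContinuousAt (fun z : E × E × K => z.2.2⁻¹) z :=
      ContinuousAt.inv₀ (by fun_prop) hz0
    exact h₃.smul (h₂.sub h₁)
  have hext : ContinuousOn (extendFrom A (diffQuotient K f)) (stepDomain K U) := by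
    refine continuousOn_extendFrom (fun z _ => hdense z) fun z hz => ?_
    by_cases hz0 : z.2.2 = 0
    · obtain ⟨x, y, t⟩ := z
      obtain rfl : t = 0 := hz0
      exact (hf x hz.1).2 y
    · exact ⟨_, (hlim z hz hz0).mono_left nhdsWithin_le_nhds⟩
  refine ⟨hcont, extendFrom A (diffQuotient K f), hext, fun x y t hz ht => ?_, hext⟩
  exact extendFrom_eq (hdense _) ((hlim _ hz ht).mono_left nhdsWithin_le_nhds)

theorem isC1At_const_prodMk (c : E) [ContinuousAdd E'] [ContinuousSMul K E'] (x : E') :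
    IsC1At K (fun y : E' => (c, y)) x := by
  refine ⟨by fun_prop, fun y => ⟨(0, y), ?_⟩⟩
  refine (tendsto_const_nhds.prodMk_nhds (tendsto_step_direction x y)).congr' ?_
  filter_upwards [eventually_step_ne_zero x y] with z hz
  simp [diffQuotient, inv_smul_smul₀ hz]

theorem isC1At_const_add (c : E) [ContinuousAdd E] [ContinuousSMul K E] (x : E) :
    IsC1At K (fun y : E => c + y) x := by
  refine ⟨by fun_prop, fun y => ⟨y, ?_⟩⟩
  refine (tendsto_step_direction x y).congr' ?_
  filter_upwards [eventually_step_ne_zero x y] with z hz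
  simp [diffQuotient, inv_smul_smul₀ hz, add_sub_add_left_eq_sub]

theorem IsC1At.add_const [ContinuousAdd F] {f : E → F} {x : E} (hf : IsC1At K f x) (c : F) :
    IsC1At K (fun y => f y + c) x := by
  refine ⟨hf.1.add continuousAt_const, fun y => ?_⟩
  obtain ⟨l, hl⟩ := hf.2 y
  exact ⟨l, hl.congr fun z => by simp [diffQuotient]⟩

/-- A map which is approximated to second order by a continuous homogeneous map `L` satisfies
`t⁻¹ h (t w') → L w` as `w' → w` and `t → 0`. -/
theorem IsPowO.tendsto_inv_smul [PolynormableSpace K F] [ContinuousSMul K E]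
    [ContinuousAdd F] {h L : E → F} (hL : Continuous L)
    (hLs : ∀ (t : K) x, L (t • x) = t • L x) (happ : IsPowO K 2 (fun x => h x - L x))
    {ι : Type*} {φ : Filter ι} {w : ι → E} {t : ι → K} {w₀ : E} (hw : Tendsto w φ (𝓝 w₀))
    (ht : Tendsto t φ (𝓝 0)) (h0 : ∀ᶠ a in φ, t a ≠ 0) :
    Tendsto (fun a => (t a)⁻¹ • h (t a • w a)) φ (𝓝 (L w₀)) := by
  have htw : Tendsto (fun a => t a • w a) φ (𝓝 0) := by simpa using ht.smul hw
  have hsmall : Tendsto (fun a => (t a)⁻¹ • (h (t a • w a) - L (t a • w a))) φ (𝓝 0) := by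
    refine tendsto_zero_of_seminorm (K := K) fun q hq => ?_
    obtain ⟨b, hb, C, hC, H⟩ := happ q hq
    have hlim : Tendsto (fun a => C * b (w a) ^ 2 * ‖t a‖) φ (𝓝 0) := by
      have h₁ : Tendsto (fun a => b (w a)) φ (𝓝 (b w₀)) := (hb.tendsto _).comp hw
      simpa using ((h₁.pow 2).const_mul C).mul ht.norm
    refine squeeze_zero' (Eventually.of_forall fun _ => apply_nonneg _ _) ?_ hlim
    filter_upwards [htw.eventually H, h0] with a ha ha0
    have hpos : 0 < ‖t a‖ := norm_pos_iff.2 ha0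
    rw [map_smul_eq_mul, Real.rpow_two] at ha
    rw [map_smul_eq_mul, norm_inv, inv_mul_le_iff₀ hpos]
    exact ha.trans (le_of_eq (by ring))
  have := hsmall.add ((hL.tendsto _).comp hw)
  rw [zero_add] at this
  refine this.congr' ?_
  filter_upwards [h0] with a ha
  simp [hLs, smul_sub, inv_smul_smul₀ ha]

/-- Write `x + t y` as the product of `x` and `t w`. Since `m (i x, x) = 0`, `w` is a difference
quotient of `m` at `(i x, x)` in direction `(0, y)`, hence converges, and so does `v = t⁻¹ h (t w)`.
As `h x = n (h x, 0)`, the quotient of `h` is that of `n` at `(h x, 0)` in direction `(0, v)`. -/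
theorem IsHolderHomGerm.isC1At [PolynormableSpace K E] [PolynormableSpace K F] [ContinuousAdd E]
    [ContinuousSMul K E] [ContinuousAdd F] {m : E × E → E} {i : E → E}
    {n : F × F → F} {h L : E → F} (hm : IsGroupGerm K m i) (hm₁ : IsC1At K m 0)
    (hn₁ : IsC1At K n 0) (hn₀ : ∀ᶠ y in 𝓝 0, n (y, 0) = y) (hh : IsHolderHomGerm K m n 1 h)
    (hL : Continuous L) (hLs : ∀ (t : K) x, L (t • x) = t • L x)
    (happ : IsPowO K 2 (fun x => h x - L x)) : IsC1At K h 0 := by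
  have hh0 : Tendsto h (𝓝 0) (𝓝 0) := hh.isPowO.tendsto_zero one_pos
  refine ⟨by rwa [ContinuousAt, hh.map_zero], fun y => ?_⟩
  have hx := tendsto_step_fst (K := K) (0 : E) y
  have hy := tendsto_step_direction (K := K) (0 : E) y
  have ht := tendsto_step_scalar (K := K) (0 : E) y
  have h0 := eventually_step_ne_zero (K := K) (0 : E) y
  have hi := (hm.isPowO_inv.tendsto_zero one_pos).comp hx
  obtain ⟨l, hl⟩ := hm₁.2 (0, y)
  have hw := tendsto_diffQuotient hl (hi.prodMk_nhds hx) (tendsto_const_nhds.prodMk_nhds hy) ht h0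
  have hv := happ.tendsto_inv_smul hL hLs hw ht h0
  obtain ⟨l', hl'⟩ := hn₁.2 (0, L l)
  have hq := tendsto_diffQuotient hl' ((hh0.comp hx).prodMk_nhds tendsto_const_nhds)
    (tendsto_const_nhds.prodMk_nhds hv) ht h0
  refine ⟨l', hq.congr' ?_⟩
  have htw := ht.smul hw
  rw [zero_smul] at htw
  filter_upwards [h0, hx.eventually hm.inv_mul,
    (hx.prodMk_nhds (tendsto_add_smul (K := K) 0 y)).eventually hm.mul_inv_mul,
    (hx.prodMk_nhds htw).eventually hh.map_mul, (hh0.comp hx).eventually hn₀]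
    with z hz h₁ h₂ h₃ h₄
  simp only [Function.comp, Prod.smul_mk, Prod.mk_add_mk, smul_zero, add_zero, h₁, sub_zero,
    smul_inv_smul₀ hz, zero_add] at h₂ h₃ h₄ ⊢
  rw [h₂] at h₃
  rw [h₄, ← h₃, diffQuotient]

end IsC1At

/-! ### Lie groups in charts centred at the unit, and translations. -/

section Charts

/-- The chart `φ` of a group around `1`, translated so that it maps `1` to `0`. -/
def groupCoord {E G : Type*} [AddCommGroup E] [TopologicalSpace E] [Group G] [TopologicalSpace G]
    (φ : OpenPartialHomeomorph G E) (g : G) : E := φ g - φ 1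

/-- The inverse of `groupCoord`. -/
def groupPoint {E G : Type*} [AddCommGroup E] [TopologicalSpace E] [Group G] [TopologicalSpace G]
    (φ : OpenPartialHomeomorph G E) (x : E) : G := φ.symm (φ 1 + x)

/-- The multiplication in the chart `groupCoord`. -/
def groupCoordMul {E G : Type*} [AddCommGroup E] [TopologicalSpace E] [Group G]
    [TopologicalSpace G] (φ : OpenPartialHomeomorph G E) (z : E × E) : E :=
  groupCoord φ (groupPoint φ z.1 * groupPoint φ z.2)

/-- The inversion in the chart `groupCoord`. -/
def groupCoordInv {E G : Type*} [AddCommGroup E] [TopologicalSpace E] [Group G]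
    [TopologicalSpace G] (φ : OpenPartialHomeomorph G E) (x : E) : E :=
  groupCoord φ (groupPoint φ x)⁻¹

variable {K : Type} [NontriviallyNormedField K]
  {E : Type*} [AddCommGroup E] [Module K E] [TopologicalSpace E]
  [IsTopologicalAddGroup E] [ContinuousSMul K E]
  {F : Type*} [AddCommGroup F] [Module K F] [TopologicalSpace F]
  [IsTopologicalAddGroup F] [ContinuousSMul K F]
  {G : Type*} [Group G] [TopologicalSpace G] {H : Type*} [Group H] [TopologicalSpace H]
  {φ : OpenPartialHomeomorph G E} {ψ : OpenPartialHomeomorph H F}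

section

omit [IsTopologicalAddGroup E] in
theorem groupPoint_zero (h1 : 1 ∈ φ.source) : groupPoint φ 0 = 1 := by
  simp [groupPoint, φ.left_inv h1]

omit [IsTopologicalAddGroup E] in
theorem groupCoord_one : groupCoord φ 1 = 0 := by
  simp [groupCoord]

theorem tendsto_groupPoint (h1 : 1 ∈ φ.source) : Tendsto (groupPoint φ) (𝓝 0) (𝓝 1) := by
  have h₁ : ContinuousAt φ.symm (φ 1 + 0) := by
    rw [add_zero]
    exact φ.symm.continuousAt (φ.map_source h1)
  have h₂ : ContinuousAt (groupPoint φ) 0 :=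
    ContinuousAt.comp (g := φ.symm) (f := fun x => φ 1 + x) h₁ (by fun_prop)
  have := h₂.tendsto
  rwa [groupPoint_zero h1] at this

omit [IsTopologicalAddGroup E] in
theorem eventually_groupPoint_groupCoord (h1 : 1 ∈ φ.source) :
    ∀ᶠ g in 𝓝 1, groupPoint φ (groupCoord φ g) = g := by
  filter_upwards [φ.open_source.mem_nhds h1] with g hg
  simp [groupPoint, groupCoord, φ.left_inv hg]

theorem eventually_add_mem_target (h1 : 1 ∈ φ.source) :
    ∀ᶠ x in 𝓝 0, φ 1 + x ∈ φ.target := by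
  have : Continuous fun x => φ 1 + x := by fun_prop
  exact (this.tendsto' 0 (φ 1) (add_zero _)).eventually
    (φ.open_target.mem_nhds (φ.map_source h1))

theorem eventually_groupCoord_groupPoint (h1 : 1 ∈ φ.source) :
    ∀ᶠ x in 𝓝 0, groupCoord φ (groupPoint φ x) = x := by
  filter_upwards [eventually_add_mem_target h1] with x hx
  simp [groupPoint, groupCoord, φ.right_inv hx]

end

variable [ChartedSpace E G] [ChartedSpace F H]

omit [IsTopologicalAddGroup E] [ContinuousSMul K E] in
theorem IsLieGroupOver.isTopologicalGroup (hG : IsLieGroupOver K E G) :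
    IsTopologicalGroup G where
  continuous_mul := hG.continuous_mul
  continuous_inv := (hG.smooth_inv 0).1

omit [IsTopologicalAddGroup E] [ContinuousSMul K E] in
theorem IsLieGroupOver.mul_mem_nhds (hG : IsLieGroupOver K E G)
    {φ₁ φ₂ φ₃ : OpenPartialHomeomorph G E} {x y : E} (hx : x ∈ φ₁.target) (hy : y ∈ φ₂.target)
    (hxy : φ₁.symm x * φ₂.symm y ∈ φ₃.source) :
    {z : E × E | z.1 ∈ φ₁.target ∧ z.2 ∈ φ₂.target ∧ φ₁.symm z.1 * φ₂.symm z.2 ∈ φ₃.source}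
      ∈ 𝓝 (x, y) := by
  have hc : ContinuousAt (fun z : E × E => φ₁.symm z.1 * φ₂.symm z.2) (x, y) :=
    ContinuousAt.comp (g := fun z : G × G => z.1 * z.2) hG.continuous_mul.continuousAt
      (((φ₁.symm.continuousAt hx).comp continuousAt_fst).prodMk
        (ContinuousAt.comp (f := Prod.snd) (x := (x, y)) (φ₂.symm.continuousAt hy)
          continuousAt_snd))
  filter_upwards [continuousAt_fst.preimage_mem_nhds (φ₁.open_target.mem_nhds hx),
    continuousAt_snd.preimage_mem_nhds (φ₂.open_target.mem_nhds hy),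
    hc.preimage_mem_nhds (φ₃.open_source.mem_nhds hxy)] with z h₁ h₂ h₃
  exact ⟨h₁, h₂, h₃⟩

/-- Left translations are of class `C^1`. -/
theorem IsLieGroupOver.isC1At_mul_left (hG : IsLieGroupOver K E G)
    {φ₁ φ₂ : OpenPartialHomeomorph G E} (h₁ : φ₁ ∈ smoothCharts K E G)
    (h₂ : φ₂ ∈ smoothCharts K E G) (g : G) {x : E} (hx : x ∈ φ₁.target)
    (hgx : g * φ₁.symm x ∈ φ₂.source) : IsC1At K (fun y => φ₂ (g * φ₁.symm y)) x := by
  set χ := chartAt E g with hχ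
  have hχs : χ ∈ smoothCharts K E G := hG.smooth_manifold _ (chart_mem_atlas E g)
  have hg : g ∈ χ.source := mem_chart_source E g
  have hU := hG.mul_mem_nhds (φ₁ := χ) (φ₃ := φ₂) (χ.map_source hg) hx (by rwa [χ.left_inv hg])
  have := (IsCk.isC1At hU (hG.smooth_mul χ hχs φ₁ h₁ φ₂ h₂ 1)).comp
    (isC1At_const_prodMk (K := K) (χ g) x)
  simpa only [χ.left_inv hg] using this

theorem IsLieGroupOver.isC1At_groupCoordMul (hG : IsLieGroupOver K E G)
    (hφ : φ ∈ smoothCharts K E G) (h1 : 1 ∈ φ.source) : IsC1At K (groupCoordMul φ) 0 := by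
  have ha := φ.map_source h1
  have hU := hG.mul_mem_nhds (φ₁ := φ) (φ₂ := φ) (φ₃ := φ) ha ha (by simpa [φ.left_inv h1])
  have h := IsCk.isC1At hU (hG.smooth_mul φ hφ φ hφ φ hφ 1)
  have h' := IsC1At.comp (g := fun z : E × E => φ (φ.symm z.1 * φ.symm z.2))
    (f := fun z : E × E => (φ 1, φ 1) + z) (x := 0)
    (by rwa [add_zero]) (isC1At_const_add (φ 1, φ 1) 0)
  refine (h'.add_const (-φ 1)).congr (Eventually.of_forall fun z => ?_)
  simp [groupCoordMul, groupCoord, groupPoint, sub_eq_add_neg]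

/-- Since `1` is neutral, the mixed second difference of the multiplication at the unit is exactly
its deviation from addition. For the inversion, `C^1` is enough. -/
theorem IsLieGroupOver.isGroupGerm [PolynormableSpace K E] (hG : IsLieGroupOver K E G)
    (hφ : φ ∈ smoothCharts K E G) (h1 : 1 ∈ φ.source) :
    IsGroupGerm K (groupCoordMul φ) (groupCoordInv φ) := by
  have := hG.isTopologicalGroup
  have ha := φ.map_source h1
  have hinv : Tendsto (fun x => (groupPoint φ x)⁻¹) (𝓝 0) (𝓝 1) := by
    simpa using (tendsto_groupPoint h1).inv
  refine ⟨fun q hq => ?_, ?_, ?_, ?_⟩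
  · have hU := hG.mul_mem_nhds (φ₁ := φ) (φ₂ := φ) (φ₃ := φ) ha ha (by simpa [φ.left_inv h1])
    obtain ⟨c, hc, d, hd, C, hC, hev⟩ :=
      IsCk.mixed_difference_le hU (hG.smooth_mul φ hφ φ hφ φ hφ 2) hq
    refine ⟨c ⊔ d, Seminorm.continuous_sup' hc hd, C, hC, ?_⟩
    have ht := eventually_add_mem_target h1
    have ht₁ := (continuous_fst.tendsto' (0 : E × E) 0 rfl).eventually ht
    have ht₂ := (continuous_snd.tendsto' (0 : E × E) 0 rfl).eventually ht
    filter_upwards [hev, ht₁, ht₂] with z hz h₁ h₂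
    have hcz : c z.1 ≤ (c ⊔ d) z.1 := by simp
    have hdz : d z.2 ≤ (c ⊔ d) z.2 := by simp
    have hd0 := apply_nonneg d z.2
    have hc0 := apply_nonneg (c ⊔ d) z.1
    simp only [φ.left_inv h1, mul_one, one_mul, φ.right_inv h₁, φ.right_inv h₂] at hz
    have e : groupCoordMul φ z - z.1 - z.2 = φ (φ.symm (φ 1 + z.1) * φ.symm (φ 1 + z.2)) -
        (φ 1 + z.1) - (φ 1 + z.2 - φ 1) := by
      simp only [groupCoordMul, groupCoord, groupPoint]
      abel
    rw [e]
    exact hz.trans (by gcongr)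
  · have hU : φ.target ∩ φ.symm ⁻¹' ((fun g : G => g⁻¹) ⁻¹' φ.source) ∈ 𝓝 (φ 1) := by
      refine (φ.symm.isOpen_inter_preimage (φ.open_source.preimage continuous_inv)).mem_nhds
        ⟨ha, ?_⟩
      simpa [φ.left_inv h1] using h1
    refine (IsCk.isPowO_sub hU ((hG.smooth_inv 1).2 φ hφ φ hφ)).congr
      (Eventually.of_forall fun x => ?_)
    simp [groupCoordInv, groupCoord, groupPoint, φ.left_inv h1]
  · filter_upwards [hinv.eventually (eventually_groupPoint_groupCoord h1)] with x hx
    rw [groupCoordMul, groupCoordInv, hx, inv_mul_cancel, groupCoord_one]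
  · have ht₁ := continuous_fst.tendsto' (0 : E × E) 0 rfl
    have ht₂ := continuous_snd.tendsto' (0 : E × E) 0 rfl
    have hdiv : Tendsto (fun z : E × E => (groupPoint φ z.1)⁻¹ * groupPoint φ z.2)
        (𝓝 0) (𝓝 1) := by
      simpa using (hinv.comp ht₁).mul ((tendsto_groupPoint h1).comp ht₂)
    filter_upwards [ht₁.eventually (hinv.eventually (eventually_groupPoint_groupCoord h1)),
      hdiv.eventually (eventually_groupPoint_groupCoord h1),
      ht₂.eventually (eventually_groupCoord_groupPoint h1)] with z h₁ h₂ h₃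
    simp only [groupCoordMul, groupCoordInv]
    rw [h₁, h₂, mul_inv_cancel_left, h₃]

omit [ContinuousSMul K E] [IsTopologicalAddGroup F] [ContinuousSMul K F] [ChartedSpace F H] in
theorem isHolderHomGerm_groupCoord [PolynormableSpace K E] [PolynormableSpace K F]
    (hG : IsLieGroupOver K E G) {f : G →* H} (hf : Continuous f) {α : ℝ}
    (h1 : 1 ∈ φ.source) (h1' : 1 ∈ ψ.source)
    (hα : HolderAt K α (φ.target ∩ φ.symm ⁻¹' (f ⁻¹' ψ.source))
      (fun y => ψ (f (φ.symm y))) (φ 1)) :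
    IsHolderHomGerm K (groupCoordMul φ) (groupCoordMul ψ) α
      (fun x => groupCoord ψ (f (groupPoint φ x))) := by
  have := hG.isTopologicalGroup
  have hfp : Tendsto (fun x => f (groupPoint φ x)) (𝓝 0) (𝓝 1) :=
    (hf.tendsto' 1 1 (map_one f)).comp (tendsto_groupPoint h1)
  have ht₁ := continuous_fst.tendsto' (0 : E × E) 0 rfl
  have ht₂ := continuous_snd.tendsto' (0 : E × E) 0 rfl
  refine ⟨by rw [groupPoint_zero h1, map_one, groupCoord_one], ?_, fun q hq => ?_⟩
  · have hmul : Tendsto (fun z : E × E => groupPoint φ z.1 * groupPoint φ z.2) (𝓝 0) (𝓝 1) := by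
      simpa using ((tendsto_groupPoint h1).comp ht₁).mul ((tendsto_groupPoint h1).comp ht₂)
    filter_upwards [hmul.eventually (eventually_groupPoint_groupCoord h1),
      ht₁.eventually (hfp.eventually (eventually_groupPoint_groupCoord h1')),
      ht₂.eventually (hfp.eventually (eventually_groupPoint_groupCoord h1'))] with z h₁ h₂ h₃
    simp only [groupCoordMul]
    rw [h₁, h₂, h₃, map_mul]
  · obtain ⟨δ, hδ, C, hC, b, hb, -, hle⟩ := hα q hq
    refine ⟨b, hb, C, hC.le, ?_⟩
    filter_upwards [(Seminorm.tendsto_zero_of_continuous hb).eventually_lt_const hδ] with x hx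
    have := hle (φ 1 + x) (by simpa [Seminorm.mem_ball] using hx)
    simpa [groupCoord, groupPoint, φ.left_inv h1] using this

/-- A homomorphism between Lie groups which is of class `C^1` at `1` is of class `C^1`. -/
theorem isCkMap_one_of_isC1At_zero [T2Space F]
    (hG : IsLieGroupOver K E G) (hH : IsLieGroupOver K F H) {f : G →* H} (hf : Continuous f)
    (hφ : φ ∈ smoothCharts K E G) (h1 : 1 ∈ φ.source)
    (hψ : ψ ∈ smoothCharts K F H) (h1' : 1 ∈ ψ.source)
    (h : IsC1At K (fun x => groupCoord ψ (f (groupPoint φ x))) 0) : IsCkMap K E F 1 f := by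
  have := hG.isTopologicalGroup
  refine ⟨hf, fun φ' hφ' ψ' hψ' => isCk_one_of_isC1At fun x hx => ?_⟩
  -- Near `g`, `f` is left translation by `g⁻¹`, followed by `f` near `1`, followed by left
  -- translation by `f g`.
  set g := φ'.symm x with hg
  have hT : IsC1At K (fun y => φ (g⁻¹ * φ'.symm y)) x :=
    hG.isC1At_mul_left hφ' hφ g⁻¹ hx.1 (by simpa [← hg] using h1)
  have hT₁ := hT.add_const (-φ 1)
  have hh := IsC1At.comp (g := fun x => groupCoord ψ (f (groupPoint φ x)))
    (f := fun y => φ (g⁻¹ * φ'.symm y) + -φ 1) (x := x)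
    (by simpa [← hg] using h) hT₁
  have hh₁ := hh.add_const (ψ 1)
  have hS : IsC1At K (fun w => ψ' (f g * ψ.symm w)) (ψ 1) :=
    hH.isC1At_mul_left hψ hψ' (f g) (ψ.map_source h1') (by
      rw [ψ.left_inv h1', mul_one]
      exact hx.2)
  have hcomp := IsC1At.comp (x := x) (g := fun w => ψ' (f g * ψ.symm w)) (f := fun y =>
    groupCoord ψ (f (groupPoint φ (φ (g⁻¹ * φ'.symm y) + -φ 1))) + ψ 1)
    (by simpa [← hg, groupPoint_zero h1, groupCoord_one] using hS) hh₁
  refine hcomp.congr ?_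
  have ht : Tendsto (fun y => g⁻¹ * φ'.symm y) (𝓝 x) (𝓝 1) := by
    simpa [← hg] using (φ'.symm.continuousAt hx.1).tendsto.const_mul g⁻¹
  filter_upwards [ht.eventually (φ.open_source.mem_nhds h1),
    ((hf.tendsto' 1 1 (map_one f)).comp ht).eventually (ψ.open_source.mem_nhds h1')] with y hy hy'
  simp only [groupPoint, groupCoord, add_neg_cancel_comm_assoc, sub_add_cancel]
  have e : f (g⁻¹ * φ'.symm y) ∈ ψ.source := hy'
  rw [φ.left_inv hy, ψ.left_inv e, ← map_mul, mul_inv_cancel_left]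

end Charts

/-! ### The theorem. -/

theorem mainTheorem2 (p : ℕ) [Fact p.Prime]
    {E : Type*} [AddCommGroup E] [Module ℚ_[p] E] [TopologicalSpace E]
    [IsTopologicalAddGroup E] [ContinuousSMul ℚ_[p] E] [T2Space E] [PolynormableSpace ℚ_[p] E]
    {F : Type*} [AddCommGroup F] [Module ℚ_[p] F] [TopologicalSpace F]
    [IsTopologicalAddGroup F] [ContinuousSMul ℚ_[p] F] [T2Space F] [PolynormableSpace ℚ_[p] F]
    {G : Type*} [Group G] [TopologicalSpace G] [ChartedSpace E G]
    {H : Type*} [Group H] [TopologicalSpace H] [ChartedSpace F H]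
    (hG : IsLieGroupOver ℚ_[p] E G) (hH : IsLieGroupOver ℚ_[p] F H)
    (hF : MackeyComplete ℚ_[p] F)
    (f : G →* H) (hf : HolderContinuousAt ℚ_[p] E F f 1) :
    IsCkMap ℚ_[p] E F 1 f := by
  obtain ⟨α, hα, -, hf1, φ, hφ, ψ, hψ, h1, h1', hH'⟩ := hf
  rw [map_one] at h1'
  have := hG.isTopologicalGroup
  have := hH.isTopologicalGroup
  -- For a homomorphism of topological groups, continuity at `1` spreads to every point.
  have hfc : Continuous f := continuous_of_continuousAt_one f hf1
  have hp0 : (p : ℚ_[p]) ≠ 0 := Nat.cast_ne_zero.2 (Fact.out : p.Prime).ne_zero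
  have hp1 : ‖(p : ℚ_[p])‖ < 1 := Padic.norm_p_lt_one
  have hm := hG.isGroupGerm hφ h1
  have hn := hH.isGroupGerm hψ h1'
  have hh := (isHolderHomGerm_groupCoord hG hfc h1 h1' hH').lipschitz hm hn.remainder hα hp0 hp1
  obtain ⟨L, hL, happ⟩ := hh.exists_additive_approx hF hm hn.remainder hp0 hp1
  have hn₀ : ∀ᶠ y in 𝓝 0, groupCoordMul ψ (y, 0) = y := by
    filter_upwards [eventually_groupCoord_groupPoint h1'] with y hy
    rw [groupCoordMul, groupPoint_zero h1', mul_one, hy]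
  exact isCkMap_one_of_isC1At_zero hG hH hfc hφ h1 hψ h1'
    (hh.isC1At hm (hG.isC1At_groupCoordMul hφ h1) (hH.isC1At_groupCoordMul hψ h1') hn₀ hL
      (L.map_padic_smul hL) happ)
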